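/- **Setting.** For a $2\times2$ matrix $A$ let $\|A\|=(\sum_{i,j}A_{ij}^2)^{1/2}$, and let $H_f$ be the Hessian of $f$. Let $T^*$ be the triangulation of $\mathbb R^2$ with vertex set $\mathbb Z^2$ whose edges are the sides of the unit lattice squares and their diagonals of slope $-1$. A *square mesh of size* $\varepsilon>0$ is a finite triangulation $T$ congruent to a subcomplex of $\varepsilon T^*$; its *axes* are the images of the coordinate axes under the congruence. Its support is the union of its simplices, its interior $\operatorname{int}T$ is the interior of the support, and $\operatorname{core}T$ is the interior of the union of the closed squares of side $\varepsilon$, with sides parallel to the axes, centred at the vertices of $T$ lying in $\operatorname{int}T$. For a function $f$ on the support of $T$, $f_T$ is the function that agrees with $f$ at the vertices of $T$ and is affine on every simplex of $T$. For a function $p$ that is affine on the simplices of $T$, the gradient cycle over $\operatorname{int} T$ is the 2-current in $\mathbb R^2\times\mathbb R^2$ $$\mathbb D(p)=\sum_{\tau}[\![\tau]\!]\times[\![\nabla_\tau]\!]+\sum_{\sigma}[\![\sigma]\!]\times[\![\nabla_\sigma^-,\nabla_\sigma^+]\!]+\sum_{\rho}[\![\rho]\!]\times[\![P_\rho]\!],$$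 where $\tau,\sigma,\rho$ run over the triangles, interior edges and interior vertices of $T$; $\nabla_\tau$ is the constant gradient of $p$ on $\tau$ and $\tau$ is oriented by $\mathbb R^2$; $\nabla^+_\sigma,\nabla^-_\sigma$ are the gradients of $p$ on the triangles to the left and right of the oriented edge $\sigma$; and $P_\rho$ is the bounded polygonal region with multiplicities whose boundary is the closed polygon $\sum_{\sigma\ni\rho}[\![\nabla_\sigma^-,\nabla_\sigma^+]\!]$, the edges $\sigma$ at $\rho$ being oriented away from $\rho$. For an open set $W\subset\operatorname{int}T$, $\mathbb D(p|_W)$ is the restriction of $\mathbb D(p)$ to $W\times\mathbb R^2$, and $\mathbf{mass}$ denotes the mass of a current, i.e. the supremum of its values on smooth compactly supported 2-forms of comass at most $1$. **Lemma 2.6.** Let $T$ be a square mesh of size $\varepsilon>0$ with $\operatorname{int}T\subset B(x_0,r_0)$ (the open disc) and $\operatorname{core}T\neq\emptyset$. Let $f$ be a continuous real function on $B(x_0,r_0)\cup\operatorname{supp}T$ that is $C^2$ on $B(x_0,r_0)$. Suppose that the axes of $T$ are parallel to eigenvectors of $H_f(x_0)$, and that $\|H_f(x)-H_f(x_0)\|<\omega$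 for all $x\in B(x_0,r_0)$. Then $1+2\sqrt2\,\|H_f\|+|\det H_f|$ is integrable on $\operatorname{core}T$, and $$ \begin{aligned} \mathbf{mass}\bigl(\mathbb D(f_T|_{\operatorname{core}T})\bigr)<{}&\int_{\operatorname{core}T}\bigl(1+2\sqrt2\,\|H_f\|+|\det H_f|\bigr)\,dA\\ &+\operatorname{area}(\operatorname{core}T)\,\Bigl[12\sqrt2\,\varepsilon^{-2}\omega r_0^2+24\,\|H_f(x_0)\|\,\varepsilon^{-2}\omega r_0^2+24\,\varepsilon^{-4}\omega^2r_0^4\\ &\qquad\qquad\qquad+2\sqrt2\,\omega+4\,\|H_f(x_0)\|\,\omega+2\omega^2\Bigr]. \end{aligned} $$ -/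

import Mathlib

open scoped ENNReal

noncomputable section

namespace PLApprox

/-! ### The plane and its cotangent bundle -/

/-- The Euclidean plane `ℝ²`. -/
abbrev Plane : Type := EuclideanSpace ℝ (Fin 2)

/-- The cotangent bundle `T*ℝ² = ℝ² × ℝ²` (covectors are identified with vectors), with the
Euclidean metric of `ℝ⁴`. -/
abbrev Cot : Type := WithLp 2 (Plane × Plane)

/-- The point (or tangent vector) of `ℝ² × ℝ²` with base component `x` and fibre component `y`. -/
def pt (x y : Plane) : Cot := WithLp.toLp 2 (x, y)

/-- The standard basis of the plane. -/
def stdVec (i : Fin 2) : Plane := EuclideanSpace.single i 1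

/-- The standard area form of the plane. -/
def areaForm (v w : Plane) : ℝ := v 0 * w 1 - v 1 * w 0

/-! ### Hessians -/

/-- The Hessian matrix of `f` at `x`. -/
def hessian (f : Plane → ℝ) (x : Plane) : Matrix (Fin 2) (Fin 2) ℝ :=
  Matrix.of fun i j => fderiv ℝ (fun y => fderiv ℝ f y) x (stdVec i) (stdVec j)

/-- The Hilbert-Schmidt norm of a matrix. -/
def hsNorm (A : Matrix (Fin 2) (Fin 2) ℝ) : ℝ := Real.sqrt (∑ i, ∑ j, A i j ^ 2)

/-! ### Forms, currents and mass -/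

/-- Differential 2-forms on `ℝ² × ℝ²`. The norm on `Cot [⋀^Fin 2]→L[ℝ] ℝ` is the comass: the
supremum of `|α (v, w)|` over vectors of length at most one, equivalently over orthonormal pairs. -/
abbrev TwoForm : Type := Cot → Cot [⋀^Fin 2]→L[ℝ] ℝ

open scoped ContDiff in
/-- `φ` is a smooth form with compact support in `W × ℝ²`. -/
structure IsTestForm (W : Set Plane) (φ : TwoForm) : Prop where
  smooth : ContDiff ℝ ∞ φ
  compact : HasCompactSupport φ
  support : tsupport φ ⊆ {z : Cot | z.fst ∈ W}

/-- A 2-dimensional current, given by its values on forms. -/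
abbrev Current : Type := TwoForm → ℝ

/-- The mass of the restriction of the current `D` to `W × ℝ²` (`W` open): the supremum of its
values on the test forms with support in `W × ℝ²` and comass at most one. -/
def massOver (W : Set Plane) (D : Current) : ℝ≥0∞ :=
  ⨆ φ : {φ : TwoForm // IsTestForm W φ ∧ ∀ z, ‖φ z‖ ≤ 1}, ENNReal.ofReal (D φ.1)

/-! ### Piecewise linear interpolation -/

/-- A geometric simplicial complex in the plane. -/
abbrev Complex2 : Type := Geometry.SimplicialComplex ℝ Plane

/-- `p` agrees with `f` at the vertices of `T` and is affine on every simplex of `T`. -/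
structure IsPLInterpolant (T : Complex2) (f p : Plane → ℝ) : Prop where
  vertex : ∀ v ∈ T.vertices, p v = f v
  affine : ∀ s ∈ T.faces, ∃ A : Plane →ᵃ[ℝ] ℝ, Set.EqOn p A (convexHull ℝ (s : Set Plane))

theorem exists_affine_extension (s : Finset Plane)
    (hs : AffineIndependent ℝ ((↑) : s → Plane)) (f : Plane → ℝ) :
    ∃ A : Plane →ᵃ[ℝ] ℝ, ∀ v ∈ s, A v = f v := by
  classical
  obtain ⟨t, hst, hti, htop⟩ := exists_subset_affineIndependent_affineSpan_eq_top
    (s := (s : Set Plane)) hs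
  have : Finite t := finite_of_fin_dim_affineIndependent ℝ hti
  have : Fintype t := Fintype.ofFinite t
  let b : AffineBasis t ℝ Plane := ⟨((↑) : t → Plane), hti, by simpa using htop⟩
  refine ⟨∑ i : t, f i • b.coord i, fun v hv => ?_⟩
  have h2 : ∀ i : t, b.coord i v = if i = ⟨v, hst hv⟩ then 1 else 0 :=
    fun i => b.coord_apply i ⟨v, hst hv⟩
  have key : ∀ (S : Finset t), (∑ i ∈ S, f i • b.coord i : Plane →ᵃ[ℝ] ℝ) v
      = ∑ i ∈ S, f i * b.coord i v := by
    intro S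
    induction S using Finset.induction_on with
    | empty => simp
    | insert a S ha ih => simp [Finset.sum_insert ha, ih]
  rw [key]
  simp [h2]

theorem exists_isPLInterpolant (T : Complex2) (f : Plane → ℝ) :
    ∃ p, IsPLInterpolant T f p := by
  classical
  choose! A hA using fun (s : Finset Plane) (hs : s ∈ T.faces) =>
    exists_affine_extension s (T.indep hs) f
  choose! S hS using fun (x : Plane) (hx : x ∈ T.space) =>
    Geometry.SimplicialComplex.mem_space_iff.1 hx
  have main : ∀ s ∈ T.faces, ∀ x ∈ convexHull ℝ (s : Set Plane), A (S x) x = A s x := by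
    intro s hs x hx
    obtain ⟨h1, h2⟩ := hS x (T.convexHull_subset_space hs hx)
    have h3 := T.inter_subset_convexHull h1 hs ⟨h2, hx⟩
    have h4 : ((S x : Set Plane) ∩ s) ⊆ {y | (A (S x) - A s) y = 0} := by
      rintro y ⟨hy1, hy2⟩
      have e1 := hA _ h1 y hy1
      have e2 := hA _ hs y hy2
      simp [e1, e2]
    have h5 : Convex ℝ {y | (A (S x) - A s) y = 0} :=
      (convex_singleton (0 : ℝ)).affine_preimage (A (S x) - A s)
    have h6 := convexHull_min h4 h5 h3
    simpa [sub_eq_zero] using h6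
  refine ⟨fun x => A (S x) x, fun v hv => ?_, fun s hs => ⟨A s, fun x hx => main s hs x hx⟩⟩
  have hv' : ({v} : Finset Plane) ∈ T.faces := hv
  have := main {v} hv' v (by simp)
  simp only [this]
  exact hA _ hv' v (by simp)

/-- The function `f_T`, equal to `f` at the vertices of `T` and affine on every simplex of `T`.
These conditions determine it on the support of `T`. -/
def plInterp (T : Complex2) (f : Plane → ℝ) : Plane → ℝ :=
  Classical.choose (exists_isPLInterpolant T f)

theorem plInterp_spec (T : Complex2) (f : Plane → ℝ) : IsPLInterpolant T f (plInterp T f) :=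
  Classical.choose_spec (exists_isPLInterpolant T f)

/-! ### The gradient cycle of a PL function -/

/-- The constant value of the gradient of `p` on the open triangle with vertex set `s`, if `p` is
affine there. -/
def triGrad (p : Plane → ℝ) (s : Finset Plane) : Plane :=
  gradient p (s.centroid ℝ id)

open Classical in
/-- An oriented edge, from `u` to `v`, of `T` that has triangles of `T` on both sides: the triangle
`u v l` on its left and the triangle `u v r` on its right. -/
structure OrientedEdge (T : Complex2) where
  u : Plane
  v : Plane
  l : Plane
  r : Plane
  left_mem : ({u, v, l} : Finset Plane) ∈ T.faces
  right_mem : ({u, v, r} : Finset Plane) ∈ T.faces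
  left_pos : 0 < areaForm (v - u) (l - u)
  right_neg : areaForm (v - u) (r - u) < 0

open Classical in
/-- The gradient `∇⁺` of `p` on the triangle to the left of an oriented edge. -/
def OrientedEdge.gradL {T : Complex2} (e : OrientedEdge T) (p : Plane → ℝ) : Plane :=
  triGrad p {e.u, e.v, e.l}

open Classical in
/-- The gradient `∇⁻` of `p` on the triangle to the right of an oriented edge. -/
def OrientedEdge.gradR {T : Complex2} (e : OrientedEdge T) (p : Plane → ℝ) : Plane :=
  triGrad p {e.u, e.v, e.r}

/-- `⟦τ⟧ × ⟦g⟧` for the triangle `τ` with vertex set `s`, oriented by the plane, and a point `g` of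
the fibre. -/
def triCurrent (s : Finset Plane) (g : Plane) : Current := fun φ =>
  ∫ x in convexHull ℝ (s : Set Plane), φ (pt x g) ![pt (stdVec 0) 0, pt (stdVec 1) 0]

/-- `⟦u, v⟧ × ⟦a, b⟧` for an oriented segment `u v` of the base and an oriented segment `a b` of the
fibre. -/
def edgeCurrent (u v a b : Plane) : Current := fun φ =>
  ∫ t in (0 : ℝ)..1, ∫ r in (0 : ℝ)..1,
    φ (pt (u + t • (v - u)) (a + r • (b - a))) ![pt (v - u) 0, pt 0 (b - a)]

/-- `⟦ρ⟧ × (c * ⟦a, b⟧)`, where the join `c * ⟦a, b⟧` of the point `c` and the oriented segment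
`a b` is the push-forward of `[0,1] × ⟦a, b⟧` under `(r, y) ↦ (1 - r) c + r y`. -/
def joinCurrent (ρ c a b : Plane) : Current := fun φ =>
  ∫ r in (0 : ℝ)..1, ∫ t in (0 : ℝ)..1,
    φ (pt ρ ((1 - r) • c + r • (a + t • (b - a))))
      ![pt 0 (a + t • (b - a) - c), pt 0 (r • (b - a))]

/-- The mean of the gradients of `p` on the triangles around an interior vertex `ρ` (each of them
lies to the left of exactly one edge starting at `ρ`). -/
def meanGrad (T : Complex2) (p : Plane → ℝ) (ρ : Plane) : Plane :=
  ((Nat.card {e : OrientedEdge T // e.u = ρ} : ℝ)⁻¹) •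
    ∑ᶠ e : {e : OrientedEdge T // e.u = ρ}, e.1.gradL p

/-- The part of the gradient cycle over the triangles: the sum of `⟦τ⟧ × ⟦∇_τ⟧`. -/
def D₂ (T : Complex2) (p : Plane → ℝ) : Current := fun φ =>
  ∑ᶠ s : {s : Finset Plane // s ∈ T.faces ∧ s.card = 3}, triCurrent s.1 (triGrad p s.1) φ

/-- The part over the edges: the sum of `⟦σ⟧ × ⟦∇⁻, ∇⁺⟧`. The summand does not depend on the
orientation of `σ`; the factor `1/2` is there because every edge occurs with both orientations. -/
def D₁ (T : Complex2) (p : Plane → ℝ) : Current := fun φ =>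
  (1 / 2) * ∑ᶠ e : OrientedEdge T, edgeCurrent e.u e.v (e.gradR p) (e.gradL p) φ

/-- The part over the vertices: the sum of `⟦ρ⟧ × ⟦P_ρ⟧`, where `P_ρ` is the polygonal region with
multiplicities whose boundary is the closed polygon formed by the segments `⟦∇⁻, ∇⁺⟧` of the edges
oriented away from `ρ`. It is the join of this polygon with a point; by the constancy theorem it
does not depend on the choice of the point, which is taken to be the mean of the gradients. -/
def D₀ (T : Complex2) (p : Plane → ℝ) : Current := fun φ =>
  ∑ᶠ e : OrientedEdge T, joinCurrent e.u (meanGrad T p e.u) (e.gradR p) (e.gradL p) φ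

/-- The gradient cycle `𝔻(p)`, over the interior of the support of `T`, of a function `p` that is
affine on the simplices of the finite complex `T`. Boundary edges of `T` carry no part of it. -/
def gradientCycle (T : Complex2) (p : Plane → ℝ) : Current := fun φ =>
  D₂ T p φ + D₁ T p φ + D₀ T p φ

/-! ### Square meshes -/

/-- The simplices of the triangulation `T*` of the plane, given by their vertices in `ℤ × ℤ`: the
nonempty sets of vertices of the two triangles into which each unit square of the lattice is divided
by its diagonal of slope `-1`. -/
def latticeFaces : Set (Finset (ℤ × ℤ)) :=
  {t | t.Nonempty ∧ ∃ m n : ℤ,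
    t ⊆ {(m, n), (m + 1, n), (m, n + 1)} ∨ t ⊆ {(m + 1, n + 1), (m, n + 1), (m + 1, n)}}

/-- The point `ε (m, n)` of the plane. -/
def latticePt (ε : ℝ) (m : ℤ × ℤ) : Plane := !₂[ε * (m.1 : ℝ), ε * (m.2 : ℝ)]

/-- `T` is a square mesh of size `ε`, with congruence `Φ`: it is finite, and it is the image under
`Φ` of a subcomplex of `ε T*`. -/
structure IsSquareMesh (ε : ℝ) (Φ : Plane ≃ᵃⁱ[ℝ] Plane) (T : Complex2) : Prop where
  finite : T.faces.Finite
  faces : ∀ s ∈ T.faces, ∃ t ∈ latticeFaces,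
    (s : Set Plane) = (fun m => Φ (latticePt ε m)) '' (t : Set (ℤ × ℤ))

/-- The direction of the `i`-th axis of a mesh with congruence `Φ`. -/
def axis (Φ : Plane ≃ᵃⁱ[ℝ] Plane) (i : Fin 2) : Plane := Φ.linearIsometryEquiv (stdVec i)

/-- The closed square of side `ε` with centre `v` and sides parallel to the axes of the mesh. -/
def closedSquare (ε : ℝ) (Φ : Plane ≃ᵃⁱ[ℝ] Plane) (v : Plane) : Set Plane :=
  {x | ∀ i, |inner ℝ (axis Φ i) (x - v)| ≤ ε / 2}

/-- The core of a mesh: the interior of the union of the closed squares of side `ε` centred at the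
vertices of `T` that lie in the interior of the support of `T`. -/
def core (ε : ℝ) (Φ : Plane ≃ᵃⁱ[ℝ] Plane) (T : Complex2) : Set Plane :=
  interior (⋃ v ∈ T.vertices ∩ interior T.space, closedSquare ε Φ v)

end PLApprox

end

noncomputable section

namespace PLApprox

open MeasureTheory

/-! ### Coordinates along the axes of a mesh -/

/-! Pair the cycle with a form of comass at most one supported over the core, whose area is V. The
triangles contribute at most V, since they overlap in null sets (`D₂_le`). Everything else is
charged to the interior vertices. The half of an edge nearer to an endpoint meets the core only if
that endpoint is an interior vertex (`IsSquareMesh.mem_interior_of_near_core`), so `D₁_le` charges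
to each interior vertex half of length times gradient jump on its six edges. `D₀_le` charges to it
the areas of the triangles that join the mean gradient to the sides of the polygon of its six
gradients. The open squares of side ε at the N interior vertices are disjoint, so N ε² ≤ V
(`card_mul_le_volume_core`), which turns bounds per vertex into bounds per unit area.

At one vertex, Taylor's formula at x₀ shows that on the vertices of the star f is, up to M = ω r₀² /
2, an affine function plus a quadratic form; the form is diagonal because the axes are eigenvectors
(`exists_lattice_expansion`). For M = 0 the six gradients take only four values, the corners of a
rectangle with sides ε|μ| and ε|ν|, where μ, ν are the eigenvalues: there is no jump across the
diagonal edges, the edge charge is (|μ| + |ν|) ε² and the area is |μν| ε². `NearRectangle` keeps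
track of the perturbation by M.

Finally |μ| + |ν| ≤ √2 ‖H‖ and μν = det H for H the Hessian at x₀ (`eigenvalue_bounds`). Replacing H
by the Hessian at the points of the core costs exactly the terms of the bracket without ε
(`const_le_setIntegral_hessian`). The inequality is strict because P = ε⁻² ω r₀² is positive and
enters with factor 12 on one side and 12√2 on the other. -/

/-- The component of a vector along the `i`-th axis of a mesh. -/
def axisCoord (Φ : Plane ≃ᵃⁱ[ℝ] Plane) (i : Fin 2) (v : Plane) : ℝ := inner ℝ (axis Φ i) v

theorem axisCoord_eq (Φ : Plane ≃ᵃⁱ[ℝ] Plane) (i : Fin 2) (v : Plane) :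
    axisCoord Φ i v = (Φ.linearIsometryEquiv.symm v) i := by
  unfold axisCoord axis
  have h := Φ.linearIsometryEquiv.inner_map_map (stdVec i) (Φ.linearIsometryEquiv.symm v)
  rw [LinearIsometryEquiv.apply_symm_apply] at h
  rw [h]
  simp [stdVec, EuclideanSpace.inner_single_left]

theorem axisCoord_add (Φ : Plane ≃ᵃⁱ[ℝ] Plane) (i : Fin 2) (v w : Plane) :
    axisCoord Φ i (v + w) = axisCoord Φ i v + axisCoord Φ i w := inner_add_right _ _ _

theorem axisCoord_sub (Φ : Plane ≃ᵃⁱ[ℝ] Plane) (i : Fin 2) (v w : Plane) :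
    axisCoord Φ i (v - w) = axisCoord Φ i v - axisCoord Φ i w := inner_sub_right _ _ _

theorem axisCoord_smul (Φ : Plane ≃ᵃⁱ[ℝ] Plane) (i : Fin 2) (c : ℝ) (v : Plane) :
    axisCoord Φ i (c • v) = c * axisCoord Φ i v := inner_smul_right _ _ _

theorem axisCoord_axis (Φ : Plane ≃ᵃⁱ[ℝ] Plane) (i j : Fin 2) :
    axisCoord Φ i (axis Φ j) = if i = j then 1 else 0 := by
  rw [axisCoord_eq]
  simp [axis, stdVec]

theorem eq_axisCoord_smul (Φ : Plane ≃ᵃⁱ[ℝ] Plane) (v : Plane) :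
    v = axisCoord Φ 0 v • axis Φ 0 + axisCoord Φ 1 v • axis Φ 1 := by
  apply Φ.linearIsometryEquiv.symm.injective
  ext j
  fin_cases j <;> simp [axisCoord_eq, axis, stdVec]

theorem inner_eq_axisCoord (Φ : Plane ≃ᵃⁱ[ℝ] Plane) (v w : Plane) :
    inner ℝ v w = axisCoord Φ 0 v * axisCoord Φ 0 w + axisCoord Φ 1 v * axisCoord Φ 1 w := by
  rw [← Φ.linearIsometryEquiv.symm.inner_map_map, axisCoord_eq, axisCoord_eq, axisCoord_eq,
    axisCoord_eq]
  simp [-LinearIsometryEquiv.inner_map_map, PiLp.inner_apply, mul_comm]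

theorem norm_le_axisCoord (Φ : Plane ≃ᵃⁱ[ℝ] Plane) (v : Plane) :
    ‖v‖ ≤ |axisCoord Φ 0 v| + |axisCoord Φ 1 v| := by
  have h : ‖v‖ ^ 2 = axisCoord Φ 0 v ^ 2 + axisCoord Φ 1 v ^ 2 := by
    rw [← real_inner_self_eq_norm_sq, inner_eq_axisCoord Φ]; ring
  apply abs_le_of_sq_le_sq' _ (by positivity) |>.2
  rw [h, add_sq, sq_abs, sq_abs]
  nlinarith [mul_nonneg (abs_nonneg (axisCoord Φ 0 v)) (abs_nonneg (axisCoord Φ 1 v))]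

theorem axisCoord_ext (Φ : Plane ≃ᵃⁱ[ℝ] Plane) {v w : Plane}
    (h : ∀ i, axisCoord Φ i v = axisCoord Φ i w) : v = w := by
  rw [eq_axisCoord_smul Φ v, eq_axisCoord_smul Φ w, h, h]

/-- `Φ` preserves the orientation of the plane. -/
def IsPositive (Φ : Plane ≃ᵃⁱ[ℝ] Plane) : Prop := areaForm (axis Φ 0) (axis Φ 1) = 1

theorem areaForm_eq_axisCoord {Φ : Plane ≃ᵃⁱ[ℝ] Plane} (hΦ : IsPositive Φ) (v w : Plane) :
    areaForm v w = axisCoord Φ 0 v * axisCoord Φ 1 w - axisCoord Φ 1 v * axisCoord Φ 0 w := by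
  conv_lhs => rw [eq_axisCoord_smul Φ v, eq_axisCoord_smul Φ w]
  unfold IsPositive areaForm at hΦ
  unfold areaForm
  simp only [PiLp.add_apply, PiLp.smul_apply, smul_eq_mul]
  linear_combination (axisCoord Φ 0 v * axisCoord Φ 1 w - axisCoord Φ 1 v * axisCoord Φ 0 w) * hΦ

theorem inner_axis_axis (Φ : Plane ≃ᵃⁱ[ℝ] Plane) (i j : Fin 2) :
    axis Φ i 0 * axis Φ j 0 + axis Φ i 1 * axis Φ j 1 = if i = j then 1 else 0 := by
  rw [← axisCoord_axis Φ, axisCoord]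
  simp [PiLp.inner_apply, mul_comm]

/-! ### Points with given coordinates -/

/-- The point with coordinates `ε x`, `ε y` with respect to the axes of a mesh. -/
def meshPt (ε : ℝ) (Φ : Plane ≃ᵃⁱ[ℝ] Plane) (x y : ℝ) : Plane := Φ !₂[ε * x, ε * y]

/-- The `i`-th coordinate of a point with respect to a mesh of size `ε`, as an affine function. -/
def meshCoord (ε : ℝ) (Φ : Plane ≃ᵃⁱ[ℝ] Plane) (i : Fin 2) : Plane →ᵃ[ℝ] ℝ :=
  (ε⁻¹ • (EuclideanSpace.proj i : Plane →L[ℝ] ℝ).toLinearMap).toAffineMap.comp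
    Φ.symm.toAffineEquiv.toAffineMap

theorem meshCoord_apply (ε : ℝ) (Φ : Plane ≃ᵃⁱ[ℝ] Plane) (i : Fin 2) (x : Plane) :
    meshCoord ε Φ i x = ε⁻¹ * Φ.symm x i := by
  simp [meshCoord]

theorem meshCoord_meshPt {ε : ℝ} (hε : ε ≠ 0) (Φ : Plane ≃ᵃⁱ[ℝ] Plane) (x y : ℝ) :
    meshCoord ε Φ 0 (meshPt ε Φ x y) = x ∧ meshCoord ε Φ 1 (meshPt ε Φ x y) = y := by
  simp [meshCoord_apply, meshPt, hε]

theorem axisCoord_sub_eq {ε : ℝ} (hε : ε ≠ 0) (Φ : Plane ≃ᵃⁱ[ℝ] Plane) (i : Fin 2) (x y : Plane) :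
    axisCoord Φ i (x - y) = ε * (meshCoord ε Φ i x - meshCoord ε Φ i y) := by
  have : Φ.linearIsometryEquiv.symm (x - y) = Φ.symm x - Φ.symm y :=
    (Φ.symm.map_vsub x y)
  rw [axisCoord_eq, this, meshCoord_apply, meshCoord_apply]
  simp only [PiLp.sub_apply]
  field_simp

theorem meshPt_sub_meshPt {ε : ℝ} (hε : ε ≠ 0) (Φ : Plane ≃ᵃⁱ[ℝ] Plane) (x y x' y' : ℝ) :
    meshPt ε Φ x y - meshPt ε Φ x' y' = (ε * (x - x')) • axis Φ 0 + (ε * (y - y')) • axis Φ 1 := by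
  apply axisCoord_ext Φ
  intro i
  rw [axisCoord_sub_eq hε]
  fin_cases i <;>
    simp [axisCoord_add, axisCoord_smul, axisCoord_axis, meshCoord_meshPt hε]

/-- The vertex of the lattice of a mesh with integer coordinates `m`. -/
def latVert (ε : ℝ) (Φ : Plane ≃ᵃⁱ[ℝ] Plane) (m : ℤ × ℤ) : Plane := Φ (latticePt ε m)

theorem latVert_eq (ε : ℝ) (Φ : Plane ≃ᵃⁱ[ℝ] Plane) (m : ℤ × ℤ) :
    latVert ε Φ m = meshPt ε Φ m.1 m.2 := rfl

theorem meshCoord_latVert {ε : ℝ} (hε : ε ≠ 0) (Φ : Plane ≃ᵃⁱ[ℝ] Plane) (m : ℤ × ℤ) :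
    meshCoord ε Φ 0 (latVert ε Φ m) = m.1 ∧ meshCoord ε Φ 1 (latVert ε Φ m) = m.2 :=
  meshCoord_meshPt hε Φ _ _

theorem latVert_injective {ε : ℝ} (hε : ε ≠ 0) (Φ : Plane ≃ᵃⁱ[ℝ] Plane) :
    Function.Injective (latVert ε Φ) := by
  intro m n h
  have h1 := meshCoord_latVert hε Φ m
  have h2 := meshCoord_latVert hε Φ n
  rw [h] at h1
  ext
  · exact_mod_cast h1.1.symm.trans h2.1
  · exact_mod_cast h1.2.symm.trans h2.2

theorem axisCoord_latVert_sub {ε : ℝ} (hε : ε ≠ 0) (Φ : Plane ≃ᵃⁱ[ℝ] Plane) (m n : ℤ × ℤ) :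
    axisCoord Φ 0 (latVert ε Φ m - latVert ε Φ n) = ε * (m.1 - n.1) ∧
      axisCoord Φ 1 (latVert ε Φ m - latVert ε Φ n) = ε * (m.2 - n.2) := by
  simp [axisCoord_sub_eq hε, meshCoord_latVert hε]

theorem areaForm_latVert {ε : ℝ} (hε : ε ≠ 0) {Φ : Plane ≃ᵃⁱ[ℝ] Plane} (hΦ : IsPositive Φ)
    (m n n' : ℤ × ℤ) :
    areaForm (latVert ε Φ n - latVert ε Φ m) (latVert ε Φ n' - latVert ε Φ m) =
      ε ^ 2 * (((n.1 - m.1) * (n'.2 - m.2) - (n.2 - m.2) * (n'.1 - m.1) : ℤ) : ℝ) := by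
  simp only [areaForm_eq_axisCoord hΦ, axisCoord_latVert_sub hε]
  push_cast
  ring

/-! ### Lattice triangles -/

/-- The lattice triangle with right angle at `b` and legs in the directions `(σ, 0)`, `(0, σ)`. -/
def latTri (b : ℤ × ℤ) (σ : ℤ) : Finset (ℤ × ℤ) := {b, (b.1 + σ, b.2), (b.1, b.2 + σ)}

theorem exists_latTri_of_mem_latticeFaces {t : Finset (ℤ × ℤ)} (ht : t ∈ latticeFaces) :
    ∃ b σ, (σ = 1 ∨ σ = -1) ∧ t ⊆ latTri b σ := by
  obtain ⟨-, m, n, h | h⟩ := ht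
  · exact ⟨(m, n), 1, Or.inl rfl, h⟩
  · refine ⟨(m + 1, n + 1), -1, Or.inr rfl, h.trans_eq ?_⟩
    simp [latTri]

theorem IsSquareMesh.exists_subset_latTri {ε : ℝ} {Φ : Plane ≃ᵃⁱ[ℝ] Plane} {T : Complex2}
    (hT : IsSquareMesh ε Φ T) {s : Finset Plane} (hs : s ∈ T.faces) :
    ∃ b σ, (σ = 1 ∨ σ = -1) ∧ ∃ t ⊆ latTri b σ, (s : Set Plane) = latVert ε Φ '' t := by
  obtain ⟨t, ht, hst⟩ := hT.faces s hs
  obtain ⟨b, σ, hσ, htb⟩ := exists_latTri_of_mem_latticeFaces ht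
  exact ⟨b, σ, hσ, t, htb, hst⟩

theorem linear_le_of_mem_convexHull {ε : ℝ} (hε : ε ≠ 0) (Φ : Plane ≃ᵃⁱ[ℝ] Plane)
    {t : Set (ℤ × ℤ)} (α β γ : ℝ) (h : ∀ m ∈ t, α * m.1 + β * m.2 ≤ γ) {x : Plane}
    (hx : x ∈ convexHull ℝ (latVert ε Φ '' t)) :
    α * meshCoord ε Φ 0 x + β * meshCoord ε Φ 1 x ≤ γ := by
  have hc : Convex ℝ {x | α * meshCoord ε Φ 0 x + β * meshCoord ε Φ 1 x ≤ γ} :=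
    (convex_Iic γ).affine_preimage (α • meshCoord ε Φ 0 + β • meshCoord ε Φ 1)
  refine convexHull_min ?_ hc hx
  rintro _ ⟨m, hm, rfl⟩
  simpa [meshCoord_latVert hε] using h m hm

/-- The point with coordinates `x`, `y` lies in the closed triangle `latTri b σ`. -/
def InClosed (b : ℤ × ℤ) (σ : ℤ) (x y : ℝ) : Prop :=
  0 ≤ σ * (x - b.1) ∧ 0 ≤ σ * (y - b.2) ∧ σ * (x - b.1) + σ * (y - b.2) ≤ 1

/-- The point with coordinates `x`, `y` lies in the open triangle `latTri b σ`. -/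
def InOpen (b : ℤ × ℤ) (σ : ℤ) (x y : ℝ) : Prop :=
  0 < σ * (x - b.1) ∧ 0 < σ * (y - b.2) ∧ σ * (x - b.1) + σ * (y - b.2) < 1

/-- The defining inequalities of the two triangles combine into strict inequalities between
integers. For equal signs these force equality of the base points; for opposite signs they are
inconsistent. Closedness of one triangle suffices, as the other supplies the strictness. -/
theorem InOpen.unique {b b' : ℤ × ℤ} {σ σ' : ℤ} (hσ : σ = 1 ∨ σ = -1) (hσ' : σ' = 1 ∨ σ' = -1)
    {x y : ℝ} (h : InClosed b σ x y) (h' : InOpen b' σ' x y) : b = b' ∧ σ = σ' := by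
  obtain ⟨m, n⟩ := b
  obtain ⟨m', n'⟩ := b'
  obtain ⟨h1, h2, h3⟩ := h
  obtain ⟨h1', h2', h3'⟩ := h'
  rcases hσ with rfl | rfl <;> rcases hσ' with rfl | rfl <;> push_cast at *
  · have a1 : (m : ℝ) < m' + 1 := by linarith
    have a2 : (n : ℝ) < n' + 1 := by linarith
    have a3 : (m' : ℝ) + n' < m + n + 1 := by linarith
    norm_cast at a1 a2 a3
    refine ⟨?_, trivial⟩
    ext <;> simp only <;> omega
  · have a1 : (m : ℝ) < m' := by linarith
    have a2 : (n : ℝ) < n' := by linarith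
    have a3 : (m' : ℝ) + n' - 1 < m + n + 1 := by linarith
    norm_cast at a1 a2
    have a3' : m' + n' - 1 < m + n + 1 := by exact_mod_cast a3
    omega
  · have a1 : (m' : ℝ) < m := by linarith
    have a2 : (n' : ℝ) < n := by linarith
    have a3 : (m : ℝ) + n - 1 < m' + n' + 1 := by linarith
    norm_cast at a1 a2
    have a3' : m + n - 1 < m' + n' + 1 := by exact_mod_cast a3
    omega
  · have a1 : (m' : ℝ) < m + 1 := by linarith
    have a2 : (n' : ℝ) < n + 1 := by linarith
    have a3 : (m : ℝ) + n < m' + n' + 1 := by linarith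
    norm_cast at a1 a2 a3
    refine ⟨?_, trivial⟩
    ext <;> simp only <;> omega

theorem inClosed_of_mem_convexHull {ε : ℝ} (hε : ε ≠ 0) (Φ : Plane ≃ᵃⁱ[ℝ] Plane)
    {b : ℤ × ℤ} {σ : ℤ} (hσ : σ = 1 ∨ σ = -1) {t : Finset (ℤ × ℤ)} (ht : t ⊆ latTri b σ)
    {x : Plane} (hx : x ∈ convexHull ℝ (latVert ε Φ '' t)) :
    InClosed b σ (meshCoord ε Φ 0 x) (meshCoord ε Φ 1 x) := by
  have h1 := linear_le_of_mem_convexHull hε Φ (-σ) 0 (-σ * b.1) (t := t) (fun m hm => by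
    have := ht hm
    simp only [latTri, Finset.mem_insert, Finset.mem_singleton] at this
    rcases hσ with rfl | rfl <;> rcases this with rfl | rfl | rfl <;> push_cast <;> linarith) hx
  have h2 := linear_le_of_mem_convexHull hε Φ 0 (-σ) (-σ * b.2) (t := t) (fun m hm => by
    have := ht hm
    simp only [latTri, Finset.mem_insert, Finset.mem_singleton] at this
    rcases hσ with rfl | rfl <;> rcases this with rfl | rfl | rfl <;> push_cast <;> linarith) hx
  have h3 := linear_le_of_mem_convexHull hε Φ σ σ (σ * b.1 + σ * b.2 + 1) (t := t) (fun m hm => by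
    have := ht hm
    simp only [latTri, Finset.mem_insert, Finset.mem_singleton] at this
    rcases hσ with rfl | rfl <;> rcases this with rfl | rfl | rfl <;> push_cast <;> linarith) hx
  exact ⟨by linarith, by linarith, by linarith⟩

/-- If a vertex of the triangle were missing from `t`, the hull of `t` would lie on the line through
the opposite side, which the open triangle does not meet. -/
theorem eq_latTri_of_inOpen {ε : ℝ} (hε : ε ≠ 0) (Φ : Plane ≃ᵃⁱ[ℝ] Plane)
    {b : ℤ × ℤ} {σ : ℤ} (hσ : σ = 1 ∨ σ = -1) {t : Finset (ℤ × ℤ)} (ht : t ⊆ latTri b σ)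
    {x : Plane} (hx : x ∈ convexHull ℝ (latVert ε Φ '' t))
    (ho : InOpen b σ (meshCoord ε Φ 0 x) (meshCoord ε Φ 1 x)) : t = latTri b σ := by
  obtain ⟨h1, h2, h3⟩ := ho
  refine ht.antisymm fun q hq => ?_
  simp only [latTri, Finset.mem_insert, Finset.mem_singleton] at hq
  by_contra hqt
  have key : ∀ m ∈ t, m ≠ q ∧ (m = b ∨ m = (b.1 + σ, b.2) ∨ m = (b.1, b.2 + σ)) := by
    intro m hm
    refine ⟨fun h => hqt (h ▸ hm), ?_⟩
    simpa [latTri] using ht hm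
  rcases hq with rfl | rfl | rfl
  · have := linear_le_of_mem_convexHull hε Φ (-σ) (-σ) (-σ * q.1 - σ * q.2 - 1) (t := t)
      (fun m hm => by
        obtain ⟨h, h'⟩ := key m hm
        rcases hσ with rfl | rfl <;> rcases h' with rfl | rfl | rfl <;> push_cast <;>
          first | exact absurd rfl h | linarith) hx
    linarith
  · have := linear_le_of_mem_convexHull hε Φ σ 0 (σ * b.1) (t := t)
      (fun m hm => by
        obtain ⟨h, h'⟩ := key m hm
        rcases hσ with rfl | rfl <;> rcases h' with rfl | rfl | rfl <;> push_cast <;>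
          first | exact absurd rfl h | linarith) hx
    linarith
  · have := linear_le_of_mem_convexHull hε Φ 0 σ (σ * b.2) (t := t)
      (fun m hm => by
        obtain ⟨h, h'⟩ := key m hm
        rcases hσ with rfl | rfl <;> rcases h' with rfl | rfl | rfl <;> push_cast <;>
          first | exact absurd rfl h | linarith) hx
    linarith

/-! ### The hexagon of neighbours of a lattice vertex -/

/-- The six directions of the edges at a lattice vertex, in counterclockwise order. -/
def hexDir : Fin 6 → ℤ × ℤ := ![(1, 0), (0, 1), (-1, 1), (-1, 0), (0, -1), (1, -1)]

theorem hexDir_injective : Function.Injective hexDir := by decide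

/-- The right-angled vertex of the triangle `0, hexDir k, hexDir (k + 1)`. -/
def hexBase : Fin 6 → ℤ × ℤ := ![(0, 0), (0, 1), (-1, 0), (0, 0), (0, -1), (1, 0)]

/-- The orientation of the triangle `0, hexDir k, hexDir (k + 1)`. -/
def hexSign : Fin 6 → ℤ := ![1, -1, 1, -1, 1, -1]

theorem hexSign_eq (k : Fin 6) : hexSign k = 1 ∨ hexSign k = -1 := by revert k; decide

theorem latTri_hex (m : ℤ × ℤ) (k : Fin 6) :
    latTri (m + hexBase k) (hexSign k) = {m, m + hexDir k, m + hexDir (k + 1)} := by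
  obtain ⟨a, b⟩ := m
  ext ⟨x, y⟩
  fin_cases k <;> simp [latTri, hexBase, hexSign, hexDir] <;> omega

theorem exists_hexDir_of_mem_latTri {b : ℤ × ℤ} {σ : ℤ} (hσ : σ = 1 ∨ σ = -1) {m n n' : ℤ × ℤ}
    (hm : m ∈ latTri b σ) (hn : n ∈ latTri b σ) (hn' : n' ∈ latTri b σ)
    (hpos : 0 < (n.1 - m.1) * (n'.2 - m.2) - (n.2 - m.2) * (n'.1 - m.1)) :
    ∃ k, n = m + hexDir k ∧ n' = m + hexDir (k + 1) := by
  obtain ⟨b1, b2⟩ := b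
  simp only [latTri, Finset.mem_insert, Finset.mem_singleton] at hm hn hn'
  have key : ∃ k, (n - m) = hexDir k ∧ (n' - m) = hexDir (k + 1) := by
    rcases hσ with rfl | rfl <;> rcases hm with rfl | rfl | rfl <;>
      rcases hn with rfl | rfl | rfl <;> rcases hn' with rfl | rfl | rfl <;>
      simp at hpos <;> simp <;> decide
  obtain ⟨k, h1, h2⟩ := key
  exact ⟨k, by rw [← h1]; abel, by rw [← h2]; abel⟩

/-! ### Stars of interior vertices -/

theorem continuous_meshPt (ε : ℝ) (Φ : Plane ≃ᵃⁱ[ℝ] Plane) {x y : ℝ → ℝ} (hx : Continuous x)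
    (hy : Continuous y) : Continuous fun t => meshPt ε Φ (x t) (y t) := by
  unfold meshPt
  refine Φ.continuous.comp ((PiLp.continuous_toLp 2 _).comp ?_)
  refine continuous_pi fun i => ?_
  fin_cases i <;> simp <;> fun_prop

theorem inOpen_hex (m : ℤ × ℤ) (k : Fin 6) {t : ℝ} (h0 : 0 < t) (h1 : t < 1 / 2) :
    InOpen (m + hexBase k) (hexSign k)
      (m.1 + t * ((hexDir k).1 + (hexDir (k + 1)).1))
      (m.2 + t * ((hexDir k).2 + (hexDir (k + 1)).2)) := by
  unfold InOpen
  refine ⟨?_, ?_, ?_⟩ <;> fin_cases k <;> simp [hexBase, hexSign, hexDir] <;> linarith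

open Classical in
-- Points slightly inside the k-th sector at the vertex belong to the support, hence to some face.
-- That face lies in a single lattice triangle, which must be the one of the sector, and it must be
-- the whole of it. So an interior vertex has its full star of six triangles.
theorem IsSquareMesh.hex_mem_faces {ε : ℝ} (hε : ε ≠ 0) {Φ : Plane ≃ᵃⁱ[ℝ] Plane} {T : Complex2}
    (hT : IsSquareMesh ε Φ T) {m : ℤ × ℤ} (hm : latVert ε Φ m ∈ interior T.space) (k : Fin 6) :
    ({latVert ε Φ m, latVert ε Φ (m + hexDir k), latVert ε Φ (m + hexDir (k + 1))} :
      Finset Plane) ∈ T.faces := by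
  set c : ℝ → Plane := fun t => meshPt ε Φ (m.1 + t * ((hexDir k).1 + (hexDir (k + 1)).1))
      (m.2 + t * ((hexDir k).2 + (hexDir (k + 1)).2)) with hc
  have hcc : Continuous c := continuous_meshPt ε Φ (by fun_prop) (by fun_prop)
  have h0 : c 0 ∈ interior T.space := by
    simpa [hc, latVert_eq] using hm
  have h1 : ∀ᶠ t in nhdsWithin (0 : ℝ) (Set.Ioi 0), c t ∈ interior T.space :=
    (hcc.continuousAt.eventually_mem (isOpen_interior.mem_nhds h0)).filter_mono nhdsWithin_le_nhds
  have h2 : ∀ᶠ t in nhdsWithin (0 : ℝ) (Set.Ioi 0), t ∈ Set.Ioo (0 : ℝ) (1 / 2) :=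
    Ioo_mem_nhdsGT (by norm_num)
  obtain ⟨t, ht, ht0, ht1⟩ := (h1.and h2).exists
  obtain ⟨s, hs, hts⟩ := Geometry.SimplicialComplex.mem_space_iff.1 (interior_subset ht)
  obtain ⟨b, σ, hσ, q, hq, hsq⟩ := hT.exists_subset_latTri hs
  rw [hsq] at hts
  have hcl := inClosed_of_mem_convexHull hε Φ hσ hq hts
  have hop := inOpen_hex m k ht0 ht1
  obtain ⟨e1, e2⟩ := meshCoord_meshPt hε Φ (m.1 + t * ((hexDir k).1 + (hexDir (k + 1)).1))
      (m.2 + t * ((hexDir k).2 + (hexDir (k + 1)).2))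
  rw [← e1] at hop
  nth_rewrite 2 [← e2] at hop
  obtain ⟨rfl, rfl⟩ := InOpen.unique hσ (hexSign_eq k) hcl hop
  have := eq_latTri_of_inOpen hε Φ hσ hq hts hop
  rw [this, latTri_hex] at hsq
  convert hs
  rw [← Finset.coe_inj, hsq]
  simp [Set.image_insert_eq]

theorem fin_six_sub_add (k : Fin 6) : k - 1 + 1 = k := by revert k; decide

open Classical in
-- With a positive frame, the signs in the definition of an oriented edge become signs of integer
-- determinants, so the left and right apexes are the neighbours of `v` in the counterclockwise
-- hexagon around `u`.
theorem OrientedEdge.exists_latVert {ε : ℝ} (hε : ε ≠ 0) {Φ : Plane ≃ᵃⁱ[ℝ] Plane}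
    (hΦ : IsPositive Φ) {T : Complex2} (hT : IsSquareMesh ε Φ T) (e : OrientedEdge T) :
    ∃ m k, e.u = latVert ε Φ m ∧ e.v = latVert ε Φ (m + hexDir k) ∧
      e.l = latVert ε Φ (m + hexDir (k + 1)) ∧ e.r = latVert ε Φ (m + hexDir (k - 1)) := by
  have hε2 : 0 < ε ^ 2 := by positivity
  obtain ⟨b, σ, hσ, t, ht, hst⟩ := hT.exists_subset_latTri e.left_mem
  obtain ⟨b', σ', hσ', t', ht', hst'⟩ := hT.exists_subset_latTri e.right_mem
  obtain ⟨m, hm, hu⟩ : e.u ∈ latVert ε Φ '' t := by rw [← hst]; simp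
  obtain ⟨n, hn, hv⟩ : e.v ∈ latVert ε Φ '' t := by rw [← hst]; simp
  obtain ⟨p, hp, hl⟩ : e.l ∈ latVert ε Φ '' t := by rw [← hst]; simp
  obtain ⟨m', hm', hu'⟩ : e.u ∈ latVert ε Φ '' t' := by rw [← hst']; simp
  obtain ⟨n', hn', hv'⟩ : e.v ∈ latVert ε Φ '' t' := by rw [← hst']; simp
  obtain ⟨q, hq, hr⟩ : e.r ∈ latVert ε Φ '' t' := by rw [← hst']; simp
  obtain rfl := latVert_injective hε Φ (hu.trans hu'.symm)
  obtain rfl := latVert_injective hε Φ (hv.trans hv'.symm)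
  have hL := e.left_pos
  have hR := e.right_neg
  rw [← hu, ← hv, ← hl, areaForm_latVert hε hΦ] at hL
  rw [← hu, ← hv, ← hr, areaForm_latVert hε hΦ] at hR
  have hL' := (mul_pos_iff_of_pos_left hε2).1 hL
  have hR' := neg_of_mul_neg_right hR hε2.le
  rw [Int.cast_pos] at hL'
  rw [Int.cast_lt_zero] at hR'
  obtain ⟨k, rfl, rfl⟩ := exists_hexDir_of_mem_latTri hσ (ht hm) (ht hn) (ht hp) hL'
  -- The triangle on the right is counterclockwise in the order `u`, `r`, `v`, so here `r` comes in
  -- direction j and `v` in direction j + 1.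
  obtain ⟨j, rfl, hj⟩ := exists_hexDir_of_mem_latTri hσ' (ht' hm') (ht' hq) (ht' hn')
    (by linarith)
  have hkj : k = j + 1 := hexDir_injective (add_left_cancel hj)
  subst hkj
  exact ⟨m, j + 1, hu.symm, hv.symm, hl.symm, by rw [← hr]; simp⟩

open Classical in
/-- The oriented edge that starts at an interior vertex in the `k`-th direction. -/
def hexEdge {ε : ℝ} (hε : ε ≠ 0) {Φ : Plane ≃ᵃⁱ[ℝ] Plane} (hΦ : IsPositive Φ) {T : Complex2}
    (hT : IsSquareMesh ε Φ T) {m : ℤ × ℤ} (hm : latVert ε Φ m ∈ interior T.space) (k : Fin 6) :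
    OrientedEdge T where
  u := latVert ε Φ m
  v := latVert ε Φ (m + hexDir k)
  l := latVert ε Φ (m + hexDir (k + 1))
  r := latVert ε Φ (m + hexDir (k - 1))
  left_mem := hT.hex_mem_faces hε hm k
  right_mem := by
    have := hT.hex_mem_faces hε hm (k - 1)
    rwa [fin_six_sub_add, Finset.pair_comm] at this
  left_pos := by
    rw [areaForm_latVert hε hΦ]
    have : 0 < ε ^ 2 := by positivity
    refine mul_pos this (Int.cast_pos.2 ?_)
    simp only [Prod.fst_add, Prod.snd_add, add_sub_cancel_left]
    revert k; decide
  right_neg := by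
    rw [areaForm_latVert hε hΦ]
    have : 0 < ε ^ 2 := by positivity
    refine mul_neg_of_pos_of_neg this (Int.cast_lt_zero.2 ?_)
    simp only [Prod.fst_add, Prod.snd_add, add_sub_cancel_left]
    revert k; decide

section Star

variable {ε : ℝ} (hε : ε ≠ 0) {Φ : Plane ≃ᵃⁱ[ℝ] Plane} (hΦ : IsPositive Φ) {T : Complex2}
  (hT : IsSquareMesh ε Φ T) {m : ℤ × ℤ} (hm : latVert ε Φ m ∈ interior T.space)

theorem hexEdge_bijective : Function.Bijective
    (fun k => (⟨hexEdge hε hΦ hT hm k, rfl⟩ : {e : OrientedEdge T // e.u = latVert ε Φ m})) := by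
  constructor
  · intro k j h
    have h1 : latVert ε Φ (m + hexDir k) = latVert ε Φ (m + hexDir j) :=
      congrArg (fun e : {e : OrientedEdge T // e.u = latVert ε Φ m} => e.1.v) h
    exact hexDir_injective (add_left_cancel (latVert_injective hε Φ h1))
  · rintro ⟨e, he⟩
    obtain ⟨n, k, h1, h2, h3, h4⟩ := e.exists_latVert hε hΦ hT
    obtain rfl := latVert_injective hε Φ (he.symm.trans h1)
    refine ⟨k, Subtype.ext ?_⟩
    cases e
    simp only at h1 h2 h3 h4
    subst h1 h2 h3 h4
    rfl

theorem finsum_star {M : Type*} [AddCommMonoid M] (F : OrientedEdge T → M) :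
    ∑ᶠ e : {e : OrientedEdge T // e.u = latVert ε Φ m}, F e.1 =
      ∑ k, F (hexEdge hε hΦ hT hm k) := by
  rw [← finsum_eq_sum_of_fintype]
  exact (finsum_eq_of_bijective _ (hexEdge_bijective hε hΦ hT hm) fun _ => rfl).symm

theorem card_star {ε : ℝ} (hε : ε ≠ 0) {Φ : Plane ≃ᵃⁱ[ℝ] Plane} (hΦ : IsPositive Φ)
    {T : Complex2} (hT : IsSquareMesh ε Φ T) {m : ℤ × ℤ}
    (hm : latVert ε Φ m ∈ interior T.space) :
    Nat.card {e : OrientedEdge T // e.u = latVert ε Φ m} = 6 := by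
  rw [← Nat.card_congr (Equiv.ofBijective _ (hexEdge_bijective hε hΦ hT hm))]
  simp

theorem meanGrad_eq (p : Plane → ℝ) :
    meanGrad T p (latVert ε Φ m) = (6 : ℝ)⁻¹ • ∑ k, (hexEdge hε hΦ hT hm k).gradL p := by
  unfold meanGrad
  rw [card_star hε hΦ hT hm, finsum_star hε hΦ hT hm (fun e => e.gradL p)]
  norm_num

/-- The sector to the right of one edge is the sector to the left of the preceding one, so the six
segments of gradients form a closed hexagonal path. -/
theorem hexEdge_gradR (p : Plane → ℝ) (k : Fin 6) :
    (hexEdge hε hΦ hT hm k).gradR p = (hexEdge hε hΦ hT hm (k - 1)).gradL p := by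
  classical
  unfold OrientedEdge.gradR OrientedEdge.gradL hexEdge
  simp only [fin_six_sub_add]
  rw [Finset.pair_comm]

end Star

/-! ### Finiteness -/

theorem IsSquareMesh.finite_vertices {ε : ℝ} {Φ : Plane ≃ᵃⁱ[ℝ] Plane} {T : Complex2}
    (hT : IsSquareMesh ε Φ T) : T.vertices.Finite := by
  rw [Geometry.SimplicialComplex.vertices_eq]
  exact hT.finite.biUnion fun s _ => s.finite_toSet

theorem mem_vertices_of_mem_face {T : Complex2} {s : Finset Plane} (hs : s ∈ T.faces) {v : Plane}
    (hv : v ∈ s) : v ∈ T.vertices := by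
  rw [Geometry.SimplicialComplex.vertices_eq]
  exact Set.mem_biUnion hs hv

theorem IsSquareMesh.finite_orientedEdge {ε : ℝ} {Φ : Plane ≃ᵃⁱ[ℝ] Plane} {T : Complex2}
    (hT : IsSquareMesh ε Φ T) : Finite (OrientedEdge T) := by
  classical
  have := hT.finite_vertices.to_subtype
  let F : OrientedEdge T → T.vertices × T.vertices × T.vertices × T.vertices := fun e =>
    (⟨e.u, mem_vertices_of_mem_face e.left_mem (by simp)⟩,
      ⟨e.v, mem_vertices_of_mem_face e.left_mem (by simp)⟩,
      ⟨e.l, mem_vertices_of_mem_face e.left_mem (by simp)⟩,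
      ⟨e.r, mem_vertices_of_mem_face e.right_mem (by simp)⟩)
  refine Finite.of_injective F fun e e' h => ?_
  simp only [F, Prod.mk.injEq, Subtype.mk.injEq] at h
  cases e
  cases e'
  simpa using h

theorem IsSquareMesh.exists_latVert {ε : ℝ} {Φ : Plane ≃ᵃⁱ[ℝ] Plane} {T : Complex2}
    (hT : IsSquareMesh ε Φ T) {v : Plane} (hv : v ∈ T.vertices) : ∃ m, v = latVert ε Φ m := by
  obtain ⟨b, σ, -, t, -, h⟩ := hT.exists_subset_latTri hv
  have : v ∈ latVert ε Φ '' t := by rw [← h]; simp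
  obtain ⟨m, -, rfl⟩ := this
  exact ⟨m, rfl⟩

open Classical in
/-- The same edge with the opposite orientation. -/
def OrientedEdge.reverse {T : Complex2} (e : OrientedEdge T) : OrientedEdge T where
  u := e.v
  v := e.u
  l := e.r
  r := e.l
  left_mem := by rw [Finset.insert_comm]; exact e.right_mem
  right_mem := by rw [Finset.insert_comm]; exact e.left_mem
  left_pos := by
    have := e.right_neg
    simp only [areaForm, PiLp.sub_apply] at this ⊢
    linarith
  right_neg := by
    have := e.left_pos
    simp only [areaForm, PiLp.sub_apply] at this ⊢
    linarith

theorem OrientedEdge.reverse_involutive (T : Complex2) :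
    Function.Involutive (OrientedEdge.reverse (T := T)) := fun _ => rfl

theorem OrientedEdge.gradL_reverse {T : Complex2} (e : OrientedEdge T) (p : Plane → ℝ) :
    e.reverse.gradL p = e.gradR p := by
  classical
  simp only [OrientedEdge.gradL, OrientedEdge.gradR, OrientedEdge.reverse]
  rw [Finset.insert_comm]

theorem OrientedEdge.gradR_reverse {T : Complex2} (e : OrientedEdge T) (p : Plane → ℝ) :
    e.reverse.gradR p = e.gradL p := by
  classical
  simp only [OrientedEdge.gradL, OrientedEdge.gradR, OrientedEdge.reverse]
  rw [Finset.insert_comm]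

/-! ### The core of a mesh -/

theorem mem_closedSquare_iff {ε : ℝ} (hε : 0 < ε) (Φ : Plane ≃ᵃⁱ[ℝ] Plane) (m : ℤ × ℤ)
    (x : Plane) : x ∈ closedSquare ε Φ (latVert ε Φ m) ↔
      |meshCoord ε Φ 0 x - m.1| ≤ 1 / 2 ∧ |meshCoord ε Φ 1 x - m.2| ≤ 1 / 2 := by
  have h : ∀ i, |inner ℝ (axis Φ i) (x - latVert ε Φ m)| ≤ ε / 2 ↔
      |meshCoord ε Φ i x - meshCoord ε Φ i (latVert ε Φ m)| ≤ 1 / 2 := by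
    intro i
    change |axisCoord Φ i (x - latVert ε Φ m)| ≤ ε / 2 ↔ _
    rw [axisCoord_sub_eq hε.ne', abs_mul, abs_of_pos hε, div_eq_mul_one_div,
      mul_le_mul_iff_right₀ hε]
  simp only [closedSquare, Set.mem_ofPred_eq, Fin.forall_fin_two, h, meshCoord_latVert hε.ne']

/-- The hexagon of the six neighbours contains the square of side 1. The signs of a, b and a + b
select the sector. The bound 1/2 is needed when a and b have the same sign: the corners ±(1/2, 1/2)
lie on the sides of the hexagon. -/
theorem exists_hex_combination {a b : ℝ} (ha : |a| ≤ 1 / 2) (hb : |b| ≤ 1 / 2) :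
    ∃ (k : Fin 6) (s t : ℝ), 0 ≤ s ∧ 0 ≤ t ∧ s + t ≤ 1 ∧
      a = s * (hexDir k).1 + t * (hexDir (k + 1)).1 ∧
      b = s * (hexDir k).2 + t * (hexDir (k + 1)).2 := by
  rw [abs_le] at ha hb
  rcases le_total 0 a with h1 | h1 <;> rcases le_total 0 b with h2 | h2
  · exact ⟨0, a, b, h1, h2, by linarith, by simp [hexDir], by simp [hexDir]⟩
  · rcases le_total 0 (a + b) with h3 | h3
    · exact ⟨5, -b, a + b, by linarith, by linarith, by linarith, by simp [hexDir],
        by simp [hexDir]⟩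
    · exact ⟨4, -(a + b), a, by linarith, by linarith, by linarith, by simp [hexDir],
        by simp [hexDir]⟩
  · rcases le_total 0 (a + b) with h3 | h3
    · exact ⟨1, a + b, -a, by linarith, by linarith, by linarith, by simp [hexDir],
        by simp [hexDir]⟩
    · exact ⟨2, b, -(a + b), by linarith, by linarith, by linarith, by simp [hexDir],
        by simp [hexDir]⟩
  · exact ⟨3, -a, -b, by linarith, by linarith, by linarith, by simp [hexDir], by simp [hexDir]⟩

theorem IsSquareMesh.closedSquare_subset_space {ε : ℝ} (hε : 0 < ε) {Φ : Plane ≃ᵃⁱ[ℝ] Plane}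
    {T : Complex2} (hT : IsSquareMesh ε Φ T) {m : ℤ × ℤ}
    (hm : latVert ε Φ m ∈ interior T.space) :
    closedSquare ε Φ (latVert ε Φ m) ⊆ T.space := by
  classical
  intro x hx
  obtain ⟨h1, h2⟩ := (mem_closedSquare_iff hε Φ m x).1 hx
  obtain ⟨k, s, t, hs, ht, hst, e1, e2⟩ := exists_hex_combination h1 h2
  have hface := hT.hex_mem_faces hε.ne' hm k
  refine T.convexHull_subset_space hface ?_
  have hsum : x = ∑ i : Fin 3, (![1 - s - t, s, t] i) •
      (![latVert ε Φ m, latVert ε Φ (m + hexDir k), latVert ε Φ (m + hexDir (k + 1))] i) := by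
    rw [← sub_eq_zero]
    have hx' : x - latVert ε Φ m = s • (latVert ε Φ (m + hexDir k) - latVert ε Φ m) +
        t • (latVert ε Φ (m + hexDir (k + 1)) - latVert ε Φ m) := by
      apply axisCoord_ext Φ
      intro i
      rw [axisCoord_add, axisCoord_smul, axisCoord_smul, axisCoord_sub_eq hε.ne']
      fin_cases i
      · simp only [Fin.zero_eta, axisCoord_latVert_sub hε.ne', meshCoord_latVert hε.ne', e1]
        simp
        ring
      · simp only [Fin.mk_one, axisCoord_latVert_sub hε.ne', meshCoord_latVert hε.ne', e2]
        simp
        ring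
    simp only [Fin.sum_univ_three, Matrix.cons_val_zero, Matrix.cons_val_one, Matrix.cons_val]
    calc _ = (x - latVert ε Φ m) - (s • (latVert ε Φ (m + hexDir k) - latVert ε Φ m) +
        t • (latVert ε Φ (m + hexDir (k + 1)) - latVert ε Φ m)) := by module
      _ = 0 := sub_eq_zero.2 hx'
  rw [hsum]
  refine (convex_convexHull ℝ _).sum_mem (fun i _ => ?_) ?_ fun i _ => ?_
  · fin_cases i <;> simp <;> linarith
  · simp only [Fin.sum_univ_three, Matrix.cons_val_zero, Matrix.cons_val_one, Matrix.cons_val]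
    ring
  · apply subset_convexHull
    fin_cases i <;> simp

theorem IsSquareMesh.core_subset {ε : ℝ} (hε : 0 < ε) {Φ : Plane ≃ᵃⁱ[ℝ] Plane}
    {T : Complex2} (hT : IsSquareMesh ε Φ T) : core ε Φ T ⊆ interior T.space := by
  refine interior_mono (Set.iUnion₂_subset fun v hv => ?_)
  obtain ⟨m, rfl⟩ := hT.exists_latVert hv.1
  exact hT.closedSquare_subset_space hε hv.2

/-- A point of the core on the nearer half of an edge at m is at most 1/2 away, in each mesh
coordinate, from some interior vertex n, and less than 1/2 away from m. So m and n differ by less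
than 1 in each coordinate and coincide. -/
theorem IsSquareMesh.mem_interior_of_near_core {ε : ℝ} (hε : 0 < ε) {Φ : Plane ≃ᵃⁱ[ℝ] Plane}
    {T : Complex2} (hT : IsSquareMesh ε Φ T) {m : ℤ × ℤ} {k : Fin 6} {t : ℝ} (h0 : 0 ≤ t)
    (h1 : t < 1 / 2)
    (h : latVert ε Φ m + t • (latVert ε Φ (m + hexDir k) - latVert ε Φ m) ∈ core ε Φ T) :
    latVert ε Φ m ∈ interior T.space := by
  obtain ⟨v, hv, hx⟩ := Set.mem_iUnion₂.1 (interior_subset h)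
  obtain ⟨n, rfl⟩ := hT.exists_latVert hv.1
  have hc : ∀ i, meshCoord ε Φ i
      (latVert ε Φ m + t • (latVert ε Φ (m + hexDir k) - latVert ε Φ m)) =
      meshCoord ε Φ i (latVert ε Φ m) + t * (meshCoord ε Φ i (latVert ε Φ (m + hexDir k)) -
        meshCoord ε Φ i (latVert ε Φ m)) := by
    intro i
    have := (meshCoord ε Φ i).apply_lineMap (latVert ε Φ m) (latVert ε Φ (m + hexDir k)) t
    simp only [AffineMap.lineMap_apply, vsub_eq_sub, vadd_eq_add, smul_eq_mul] at this
    rw [add_comm, this, add_comm]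
  rw [mem_closedSquare_iff hε, hc, hc] at hx
  simp only [meshCoord_latVert hε.ne', Prod.fst_add, Prod.snd_add, Int.cast_add,
    add_sub_cancel_left, abs_le] at hx
  obtain ⟨⟨a1, a2⟩, b1, b2⟩ := hx
  have hd : ∀ j : Fin 6, ((-1 : ℤ) ≤ (hexDir j).1 ∧ (hexDir j).1 ≤ 1) ∧
    ((-1 : ℤ) ≤ (hexDir j).2 ∧ (hexDir j).2 ≤ 1) := by decide
  obtain ⟨⟨d1, d2⟩, d3, d4⟩ := hd k
  have d1' : (-1 : ℝ) ≤ (hexDir k).1 := by exact_mod_cast d1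
  have d2' : ((hexDir k).1 : ℝ) ≤ 1 := by exact_mod_cast d2
  have d3' : (-1 : ℝ) ≤ (hexDir k).2 := by exact_mod_cast d3
  have d4' : ((hexDir k).2 : ℝ) ≤ 1 := by exact_mod_cast d4
  have c1 : (m.1 : ℝ) < n.1 + 1 := by nlinarith
  have c2 : (n.1 : ℝ) < m.1 + 1 := by nlinarith
  have c3 : (m.2 : ℝ) < n.2 + 1 := by nlinarith
  have c4 : (n.2 : ℝ) < m.2 + 1 := by nlinarith
  norm_cast at c1 c2 c3 c4
  have : m = n := by ext <;> omega
  rw [this]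
  exact hv.2

/-- The open square of side `ε` with centre `v` and sides parallel to the axes. -/
def openSquare (ε : ℝ) (Φ : Plane ≃ᵃⁱ[ℝ] Plane) (v : Plane) : Set Plane :=
  {x | ∀ i, axisCoord Φ i (x - v) ∈ Set.Ioo (-(ε / 2)) (ε / 2)}

theorem openSquare_eq_preimage (ε : ℝ) (Φ : Plane ≃ᵃⁱ[ℝ] Plane) (v : Plane) :
    openSquare ε Φ v = (fun x => WithLp.ofLp (Φ.linearIsometryEquiv.symm (x - v))) ⁻¹'
      (Set.univ.pi fun _ => Set.Ioo (-(ε / 2)) (ε / 2)) := by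
  ext x
  simp [openSquare, axisCoord_eq]

theorem isOpen_openSquare (ε : ℝ) (Φ : Plane ≃ᵃⁱ[ℝ] Plane) (v : Plane) :
    IsOpen (openSquare ε Φ v) := by
  rw [openSquare_eq_preimage]
  refine (isOpen_set_pi Set.finite_univ fun _ _ => isOpen_Ioo).preimage ?_
  exact (PiLp.continuous_ofLp 2 _).comp (Φ.linearIsometryEquiv.symm.continuous.comp (by fun_prop))

theorem volume_openSquare {ε : ℝ} (hε : 0 < ε) (Φ : Plane ≃ᵃⁱ[ℝ] Plane) (v : Plane) :
    volume (openSquare ε Φ v) = ENNReal.ofReal (ε ^ 2) := by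
  rw [openSquare_eq_preimage]
  have h1 : MeasurePreserving (fun x : Plane => x - v) volume volume :=
    measurePreserving_sub_right volume v
  have h2 := (PiLp.volume_preserving_ofLp (Fin 2)).comp
    (Φ.linearIsometryEquiv.symm.measurePreserving.comp h1)
  have h3 := h2.measure_preimage (s := Set.univ.pi fun _ => Set.Ioo (-(ε / 2)) (ε / 2))
    (MeasurableSet.univ_pi fun _ => measurableSet_Ioo).nullMeasurableSet
  refine h3.trans ?_
  rw [Real.volume_pi_Ioo, Fin.prod_univ_two, ← ENNReal.ofReal_mul (by linarith)]
  congr 1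
  ring

theorem volume_core_lt_top {ε : ℝ} (hε : 0 < ε) {Φ : Plane ≃ᵃⁱ[ℝ] Plane}
    {T : Complex2} (hT : IsSquareMesh ε Φ T) : volume (core ε Φ T) < ⊤ := by
  have hb : IsCompact T.space := hT.finite.isCompact_biUnion fun s _ =>
    s.finite_toSet.isCompact_convexHull (𝕜 := ℝ)
  exact (measure_mono ((hT.core_subset hε).trans interior_subset)).trans_lt hb.measure_lt_top

theorem card_mul_le_volume_core {ε : ℝ} (hε : 0 < ε) {Φ : Plane ≃ᵃⁱ[ℝ] Plane}
    {T : Complex2} (hT : IsSquareMesh ε Φ T) (I : Finset Plane)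
    (hI : ∀ v ∈ I, v ∈ T.vertices ∩ interior T.space) :
    I.card * ε ^ 2 ≤ volume.real (core ε Φ T) := by
  have hdisj : Set.PairwiseDisjoint (I : Set Plane) (openSquare ε Φ) := by
    intro v hv w hw hvw
    obtain ⟨m, rfl⟩ := hT.exists_latVert (hI v hv).1
    obtain ⟨n, rfl⟩ := hT.exists_latVert (hI w hw).1
    refine Set.disjoint_left.2 fun x hx hy => hvw ?_
    have key : ∀ i, |meshCoord ε Φ i (latVert ε Φ m) - meshCoord ε Φ i (latVert ε Φ n)| < 1 := by
      intro i
      have h1 := hx i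
      have h2 := hy i
      have h3 : axisCoord Φ i (latVert ε Φ m - latVert ε Φ n) =
          axisCoord Φ i (x - latVert ε Φ n) - axisCoord Φ i (x - latVert ε Φ m) := by
        rw [← axisCoord_sub]; congr 1; abel
      have h4 : |ε * (meshCoord ε Φ i (latVert ε Φ m) - meshCoord ε Φ i (latVert ε Φ n))| < ε := by
        rw [← axisCoord_sub_eq hε.ne', h3, abs_lt]
        constructor <;> linarith [h1.1, h1.2, h2.1, h2.2]
      rw [abs_mul, abs_of_pos hε] at h4
      by_contra h
      nlinarith
    have k0 := key 0
    have k1 := key 1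
    simp only [meshCoord_latVert hε.ne'] at k0 k1
    norm_cast at k0 k1
    rw [Int.abs_lt_one_iff] at k0 k1
    congr 1
    ext <;> omega
  have hsub : (⋃ v ∈ I, openSquare ε Φ v) ⊆ core ε Φ T := by
    refine interior_maximal ?_ (isOpen_biUnion fun v _ => isOpen_openSquare ε Φ v)
    refine Set.iUnion₂_subset fun v hv => ?_
    refine Set.Subset.trans ?_ (Set.subset_biUnion_of_mem (hI v hv))
    intro x hx i
    exact abs_le.2 ⟨(hx i).1.le, (hx i).2.le⟩
  have h1 := measureReal_mono hsub (volume_core_lt_top hε hT).ne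
  rw [measureReal_biUnion_finset hdisj (fun v _ => (isOpen_openSquare ε Φ v).measurableSet)
    (fun v _ => by rw [volume_openSquare hε]; exact ENNReal.ofReal_ne_top)] at h1
  refine le_trans (le_of_eq ?_) h1
  rw [Finset.sum_congr rfl (fun v _ => show volume.real (openSquare ε Φ v) = ε ^ 2 by
    rw [Measure.real, volume_openSquare hε, ENNReal.toReal_ofReal (by positivity)])]
  simp

/-! ### Values of currents on forms of comass at most one -/

theorem IsTestForm.eq_zero {W : Set Plane} {φ : TwoForm} (hφ : IsTestForm W φ) {x : Plane}
    (hx : x ∉ W) (y : Plane) : φ (pt x y) = 0 := by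
  by_contra h
  exact hx (hφ.support (subset_tsupport φ h))

theorem norm_pt_left (v : Plane) : ‖pt v 0‖ = ‖v‖ := WithLp.norm_toLp_fst 2 Plane Plane v

theorem norm_pt_right (v : Plane) : ‖pt 0 v‖ = ‖v‖ := WithLp.norm_toLp_snd 2 Plane Plane v

theorem norm_stdVec (i : Fin 2) : ‖stdVec i‖ = 1 := by simp [stdVec]

theorem norm_form_le {α : Cot [⋀^Fin 2]→L[ℝ] ℝ} (hα : ‖α‖ ≤ 1) (v w : Cot) :
    ‖α ![v, w]‖ ≤ ‖v‖ * ‖w‖ := by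
  have h := α.le_opNorm ![v, w]
  simp only [Fin.prod_univ_two, Matrix.cons_val_zero, Matrix.cons_val_one] at h
  exact h.trans (mul_le_of_le_one_left (by positivity) hα)

/-- A 2-form restricted to the two-dimensional fibre is a multiple of the area form. For the vertex
part this gives a bound by areas; a bound by products of lengths would not produce the determinant.
-/
theorem form_fibre (α : Cot [⋀^Fin 2]→L[ℝ] ℝ) (v w : Plane) :
    α ![pt 0 v, pt 0 w] = areaForm v w * α ![pt 0 (stdVec 0), pt 0 (stdVec 1)] := by
  have hpt : ∀ v : Plane, pt 0 v = v 0 • pt 0 (stdVec 0) + v 1 • pt 0 (stdVec 1) := by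
    intro v
    have hv : v = v 0 • stdVec 0 + v 1 • stdVec 1 := by
      ext i; fin_cases i <;> simp [stdVec]
    apply WithLp.ofLp_injective
    refine Prod.ext ?_ ?_
    · simp [pt]
    · simpa [pt] using hv
  have h0 : ∀ x, α ![x, x] = 0 := fun x =>
    α.map_eq_zero_of_eq ![x, x] (i := 0) (j := 1) (by simp) (by simp)
  have hswap : ∀ x y, α ![x, y] = - α ![y, x] := by
    intro x y
    have h := α.map_eq_zero_of_eq ![x + y, x + y] (i := 0) (j := 1) (by simp) (by simp)
    have hadd : ∀ x y z, α ![x, y + z] = α ![x, y] + α ![x, z] := by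
      intro x y z
      have hu : ∀ z, Function.update ![x, 0] 1 z = ![x, z] := fun z => by
        funext i; fin_cases i <;> simp
      have := α.map_update_add ![x, 0] 1 y z
      rwa [hu, hu, hu] at this
    rw [α.vecCons_add, hadd, hadd, h0, h0] at h
    linarith
  have hlin : ∀ (a b : ℝ) (x y z), α ![a • x + b • y, z] = a * α ![x, z] + b * α ![y, z] := by
    intro a b x y z
    rw [α.vecCons_add, α.vecCons_smul, α.vecCons_smul, smul_eq_mul, smul_eq_mul]
  rw [hpt v, hpt w, hlin, hswap (pt 0 (stdVec 0)) (_ + _), hlin,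
    hswap (pt 0 (stdVec 1)) (_ + _), hlin, h0, h0, hswap (pt 0 (stdVec 1)) (pt 0 (stdVec 0)),
    areaForm]
  ring

theorem abs_form_fibre_le {α : Cot [⋀^Fin 2]→L[ℝ] ℝ} (hα : ‖α‖ ≤ 1) (v w : Plane) :
    ‖α ![pt 0 v, pt 0 w]‖ ≤ |areaForm v w| := by
  rw [form_fibre, norm_mul, Real.norm_eq_abs]
  refine mul_le_of_le_one_right (abs_nonneg _) ((norm_form_le hα _ _).trans_eq ?_)
  rw [norm_pt_right, norm_pt_right, norm_stdVec, norm_stdVec, one_mul]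

/-- The Jacobian of the join is linear in r and independent of t; integrating r over [0, 1] gives
the factor 1/2 of the area of a triangle. -/
theorem areaForm_self_left (c a b : Plane) (r t : ℝ) :
    areaForm (a + t • (b - a) - c) (r • (b - a)) = r * areaForm (a - c) (b - a) := by
  simp only [areaForm, PiLp.add_apply, PiLp.sub_apply, PiLp.smul_apply, smul_eq_mul]
  ring

theorem triCurrent_le {W : Set Plane} {φ : TwoForm} (hφ : IsTestForm W φ)
    (h1 : ∀ z, ‖φ z‖ ≤ 1) (s : Finset Plane) (g : Plane) :
    triCurrent s g φ ≤ volume.real (convexHull ℝ (s : Set Plane) ∩ W) := by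
  have hK : IsCompact (convexHull ℝ (s : Set Plane)) :=
    s.finite_toSet.isCompact_convexHull (𝕜 := ℝ)
  unfold triCurrent
  rw [setIntegral_eq_of_subset_of_forall_sdiff_eq_zero
    (s := convexHull ℝ (s : Set Plane) ∩ W) hK.measurableSet Set.inter_subset_left]
  · refine (le_abs_self _).trans ?_
    have h := norm_setIntegral_le_of_norm_le_const (μ := volume) (C := 1)
      (s := convexHull ℝ (s : Set Plane) ∩ W)
      (f := fun x => φ (pt x g) ![pt (stdVec 0) 0, pt (stdVec 1) 0])
      ((measure_mono Set.inter_subset_left).trans_lt hK.measure_lt_top) fun x _ => by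
        refine (norm_form_le (h1 _) _ _).trans_eq ?_
        rw [norm_pt_left, norm_pt_left, norm_stdVec, norm_stdVec, one_mul]
    rwa [one_mul] at h
  · rintro x ⟨hx, hxW⟩
    rw [hφ.eq_zero fun h => hxW ⟨hx, h⟩]
    rfl

theorem joinCurrent_le {φ : TwoForm} (h1 : ∀ z, ‖φ z‖ ≤ 1) (ρ c a b : Plane) :
    joinCurrent ρ c a b φ ≤ |areaForm (a - c) (b - a)| / 2 := by
  unfold joinCurrent
  refine (le_abs_self _).trans ?_
  have h := intervalIntegral.norm_integral_le_of_norm_le (μ := volume) zero_le_one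
    (g := fun r : ℝ => r * |areaForm (a - c) (b - a)|)
    (f := fun r : ℝ => ∫ t in (0 : ℝ)..1, φ (pt ρ ((1 - r) • c + r • (a + t • (b - a))))
      ![pt 0 (a + t • (b - a) - c), pt 0 (r • (b - a))])
    (Filter.Eventually.of_forall fun r hr => by
      have := intervalIntegral.norm_integral_le_of_norm_le_const (a := 0) (b := 1)
        (C := r * |areaForm (a - c) (b - a)|)
        (f := fun t : ℝ => φ (pt ρ ((1 - r) • c + r • (a + t • (b - a))))
          ![pt 0 (a + t • (b - a) - c), pt 0 (r • (b - a))]) fun t _ => by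
            refine (abs_form_fibre_le (h1 _) _ _).trans_eq ?_
            rw [areaForm_self_left, abs_mul, abs_of_pos hr.1]
      simpa using this)
    (by apply Continuous.intervalIntegrable; fun_prop)
  refine h.trans_eq ?_
  rw [intervalIntegral.integral_mul_const, integral_id]
  ring

/-- The numbers c₀ and c₁ serve as indicators (0 or 1) of whether the first and the second half of
the edge may meet `W`; each half then contributes half of the full product. -/
theorem edgeCurrent_le {W : Set Plane} {φ : TwoForm} (hφ : IsTestForm W φ)
    (h1 : ∀ z, ‖φ z‖ ≤ 1) (u v a b : Plane) {c₀ c₁ : ℝ}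
    (h₀ : ∀ t ∈ Set.Ioo (0 : ℝ) (1 / 2), u + t • (v - u) ∈ W → c₀ = 1)
    (h₁ : ∀ t ∈ Set.Ioo (1 / 2 : ℝ) 1, u + t • (v - u) ∈ W → c₁ = 1)
    (hc₀ : 0 ≤ c₀) (hc₁ : 0 ≤ c₁) :
    edgeCurrent u v a b φ ≤ ‖v - u‖ * ‖b - a‖ * (c₀ / 2 + c₁ / 2) := by
  set C := ‖v - u‖ * ‖b - a‖ with hC
  have hC0 : 0 ≤ C := by positivity
  set g : ℝ → ℝ := fun t => if t ≤ 1 / 2 then C * c₀ else C * c₁ with hg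
  have hgl : ∀ t ∈ Set.Ioc (0 : ℝ) (1 / 2), C * c₀ = g t := fun t ht => by
    rw [hg]; simp only; rw [if_pos ht.2]
  have hgr : ∀ t ∈ Set.Ioc (1 / 2 : ℝ) 1, C * c₁ = g t := fun t ht => by
    rw [hg]; simp only; rw [if_neg (not_le.2 ht.1)]
  have i1 : IntervalIntegrable g volume 0 (1 / 2) := by
    refine (intervalIntegrable_const (c := C * c₀)).congr ?_
    intro t ht
    rw [Set.uIoc_of_le (by norm_num)] at ht
    exact hgl t ht
  have i2 : IntervalIntegrable g volume (1 / 2) 1 := by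
    refine (intervalIntegrable_const (c := C * c₁)).congr ?_
    intro t ht
    rw [Set.uIoc_of_le (by norm_num)] at ht
    exact hgr t ht
  unfold edgeCurrent
  refine (le_abs_self _).trans ?_
  have h := intervalIntegral.norm_integral_le_of_norm_le (μ := volume) zero_le_one (g := g)
    (f := fun t : ℝ => ∫ r in (0 : ℝ)..1,
      φ (pt (u + t • (v - u)) (a + r • (b - a))) ![pt (v - u) 0, pt 0 (b - a)])
    (by
      -- The midpoint belongs to neither half, and the endpoint t = 1 is in the interval of
      -- integration but not in the open half; both are null.
      have hne : ∀ᵐ t : ℝ, t ≠ 1 / 2 ∧ t ≠ 1 := by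
        refine Filter.Eventually.and ?_ ?_ <;> simp [ae_iff]
      filter_upwards [hne] with t ⟨ht1, ht2⟩ ht
      have hin : ‖∫ r in (0 : ℝ)..1,
          φ (pt (u + t • (v - u)) (a + r • (b - a))) ![pt (v - u) 0, pt 0 (b - a)]‖ ≤ C := by
        have := intervalIntegral.norm_integral_le_of_norm_le_const (a := 0) (b := 1) (C := C)
          (f := fun r : ℝ => φ (pt (u + t • (v - u)) (a + r • (b - a)))
            ![pt (v - u) 0, pt 0 (b - a)]) fun r _ => by
              refine (norm_form_le (h1 _) _ _).trans_eq ?_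
              rw [norm_pt_left, norm_pt_right]
        simpa using this
      have hgn : 0 ≤ g t := by
        rw [hg]; simp only; split_ifs <;> positivity
      by_cases hW : u + t • (v - u) ∈ W
      · refine hin.trans ?_
        rcases lt_or_gt_of_ne ht1 with h | h
        · rw [← hgl t ⟨ht.1, h.le⟩, h₀ t ⟨ht.1, h⟩ hW, mul_one]
        · rw [← hgr t ⟨h, ht.2⟩, h₁ t ⟨h, lt_of_le_of_ne ht.2 ht2⟩ hW, mul_one]
      · simpa [hφ.eq_zero hW] using hgn)
    (i1.trans i2)
  refine h.trans_eq ?_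
  rw [← intervalIntegral.integral_add_adjacent_intervals i1 i2,
    intervalIntegral.integral_congr_Ioo_of_le (g := fun _ => C * c₀) (by norm_num)
      fun t ht => (hgl t ⟨ht.1, ht.2.le⟩).symm,
    intervalIntegral.integral_congr_Ioo_of_le (a := 1 / 2) (g := fun _ => C * c₁) (by norm_num)
      fun t ht => (hgr t ⟨ht.1, ht.2.le⟩).symm]
  simp only [intervalIntegral.integral_const, smul_eq_mul]
  ring

/-! ### The mass of the parts of the gradient cycle -/

theorem D₂_le {T : Complex2} (hfin : T.faces.Finite) {W : Set Plane} (hW : IsOpen W)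
    (hWv : volume W ≠ ⊤) {φ : TwoForm} (hφ : IsTestForm W φ) (h1 : ∀ z, ‖φ z‖ ≤ 1)
    (p : Plane → ℝ) : D₂ T p φ ≤ volume.real W := by
  classical
  have : Finite {s : Finset Plane // s ∈ T.faces ∧ s.card = 3} :=
    (hfin.subset fun s hs => hs.1).to_subtype
  have := Fintype.ofFinite {s : Finset Plane // s ∈ T.faces ∧ s.card = 3}
  unfold D₂
  rw [finsum_eq_sum_of_fintype]
  refine (Finset.sum_le_sum fun s _ => triCurrent_le hφ h1 s.1 _).trans ?_
  rw [← measureReal_biUnion_finset₀]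
  · exact measureReal_mono (Set.iUnion₂_subset fun _ _ => Set.inter_subset_right) hWv
  · intro s _ t _ hst
    -- Distinct triangles share at most two vertices. They meet in the hull of the shared ones,
    -- which lies in a proper affine subspace and is therefore null.
    have hcard : (s.1 ∩ t.1).card < 3 := by
      refine (Finset.card_lt_card ?_).trans_eq s.2.2
      refine (Finset.inter_subset_left.ssubset_of_ne fun h => hst ?_)
      refine Subtype.ext (Finset.eq_of_subset_of_card_le (Finset.inter_eq_left.1 h) ?_)
      rw [s.2.2, t.2.2]
    have hsub : (convexHull ℝ (s.1 : Set Plane) ∩ W) ∩ (convexHull ℝ (t.1 : Set Plane) ∩ W) ⊆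
        affineSpan ℝ ((s.1 ∩ t.1 : Finset Plane) : Set Plane) := by
      rintro x ⟨⟨hx, -⟩, hx', -⟩
      have := T.inter_subset_convexHull s.2.1 t.2.1 ⟨hx, hx'⟩
      rw [Finset.coe_inter]
      exact convexHull_subset_affineSpan _ this
    refine measure_mono_null hsub (Measure.addHaar_affineSubspace _ _ fun htop => ?_)
    have hne : (s.1 ∩ t.1).Nonempty := by
      by_contra h
      rw [Finset.not_nonempty_iff_eq_empty.1 h] at htop
      simp at htop
    have hind := T.indep (T.down_closed s.2.1 Finset.inter_subset_left hne)
    have h3 := hind.affineSpan_eq_top_iff_card_eq_finrank_add_one.1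
      (by rw [Subtype.range_coe]; exact htop)
    rw [Fintype.card_coe, finrank_euclideanSpace_fin] at h3
    omega
  · intro s _
    exact ((s.1.finite_toSet.isCompact_convexHull (𝕜 := ℝ)).measurableSet.inter
      hW.measurableSet).nullMeasurableSet

/-- Group the edges by their starting vertex: over an interior vertex the fibre is exactly the six
edges of the hexagon. -/
theorem sum_star_le {ε : ℝ} (hε : ε ≠ 0) {Φ : Plane ≃ᵃⁱ[ℝ] Plane} (hΦ : IsPositive Φ)
    {T : Complex2} (hT : IsSquareMesh ε Φ T) [Fintype (OrientedEdge T)] {I : Finset Plane}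
    (hI : ∀ v, v ∈ I ↔ v ∈ T.vertices ∩ interior T.space) (F : OrientedEdge T → ℝ) {B : ℝ}
    (hB : ∀ (m : ℤ × ℤ) (hm : latVert ε Φ m ∈ interior T.space),
      ∑ k, F (hexEdge hε hΦ hT hm k) ≤ B) :
    ∑ e : OrientedEdge T with e.u ∈ I, F e ≤ I.card * B := by
  classical
  rw [← Finset.sum_fiberwise_of_maps_to (g := fun e : OrientedEdge T => e.u) (t := I)
    (by simp)]
  refine (Finset.sum_le_card_nsmul _ _ B fun v hv => ?_).trans_eq (nsmul_eq_mul _ _)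
  obtain ⟨m, rfl⟩ := hT.exists_latVert ((hI v).1 hv).1
  refine le_trans (le_of_eq ?_) (hB m ((hI _).1 hv).2)
  rw [← finsum_star, finsum_eq_sum_of_fintype, Finset.filter_filter]
  refine Finset.sum_subtype _ (fun e => ?_) F
  simp only [Finset.mem_filter, Finset.mem_univ, true_and]
  exact ⟨fun h => h.2, fun h => ⟨h ▸ hv, h⟩⟩

theorem D₁_le {ε : ℝ} (hε : 0 < ε) {Φ : Plane ≃ᵃⁱ[ℝ] Plane} (hΦ : IsPositive Φ)
    {T : Complex2} (hT : IsSquareMesh ε Φ T) {I : Finset Plane}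
    (hI : ∀ v, v ∈ I ↔ v ∈ T.vertices ∩ interior T.space) {φ : TwoForm}
    (hφ : IsTestForm (core ε Φ T) φ) (h1 : ∀ z, ‖φ z‖ ≤ 1) (p : Plane → ℝ) {B : ℝ}
    (hB : ∀ (m : ℤ × ℤ) (hm : latVert ε Φ m ∈ interior T.space),
      ∑ k, ‖(hexEdge hε.ne' hΦ hT hm k).v - (hexEdge hε.ne' hΦ hT hm k).u‖ *
        ‖(hexEdge hε.ne' hΦ hT hm k).gradL p - (hexEdge hε.ne' hΦ hT hm k).gradR p‖ ≤ B) :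
    D₁ T p φ ≤ I.card * (B / 2) := by
  classical
  have := hT.finite_orientedEdge
  have := Fintype.ofFinite (OrientedEdge T)
  set E : OrientedEdge T → ℝ := fun e => ‖e.v - e.u‖ * ‖e.gradL p - e.gradR p‖ with hE
  set c : Plane → ℝ := fun v => if v ∈ I then 1 else 0 with hc
  have hc0 : ∀ v, 0 ≤ c v := fun v => by rw [hc]; simp only; split_ifs <;> norm_num
  have hedge : ∀ e : OrientedEdge T, edgeCurrent e.u e.v (e.gradR p) (e.gradL p) φ ≤
      E e * (c e.u / 2 + c e.v / 2) := by
    intro e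
    refine edgeCurrent_le hφ h1 _ _ _ _ ?_ ?_ (hc0 _) (hc0 _)
    · intro t ht hmem
      obtain ⟨m, k, hu, hv, -⟩ := e.exists_latVert hε.ne' hΦ hT
      rw [hu, hv] at hmem
      have := hT.mem_interior_of_near_core hε ht.1.le ht.2 hmem
      rw [← hu] at this
      exact if_pos ((hI _).2 ⟨mem_vertices_of_mem_face e.left_mem (by simp), this⟩)
    · intro t ht hmem
      obtain ⟨m, k, hu, hv, -⟩ := e.reverse.exists_latVert hε.ne' hΦ hT
      change e.v = _ at hu
      change e.u = _ at hv
      -- The second half of an edge is the first half of the reversed edge.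
      have hrev : e.u + t • (e.v - e.u) = e.v + (1 - t) • (e.u - e.v) := by module
      rw [hrev, hu, hv] at hmem
      have := hT.mem_interior_of_near_core hε (by linarith [ht.2]) (by linarith [ht.1]) hmem
      rw [← hu] at this
      exact if_pos ((hI _).2 ⟨mem_vertices_of_mem_face e.left_mem (by simp), this⟩)
  have hErev : ∀ e, E e.reverse = E e := by
    intro e
    simp only [hE, e.gradL_reverse, e.gradR_reverse]
    rw [norm_sub_rev (e.gradR p)]
    congr 1
    exact norm_sub_rev _ _
  -- Reversal preserves length times jump and exchanges the endpoints, so the charges to the ends of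
  -- the edges have the same total as the charges to their starts.
  have hsymm : ∑ e, E e * c e.v = ∑ e, E e * c e.u := by
    rw [← Equiv.sum_comp (OrientedEdge.reverse_involutive T).toPerm fun e => E e * c e.u]
    refine Finset.sum_congr rfl fun e _ => ?_
    change _ = E e.reverse * c e.v
    rw [hErev]
  unfold D₁
  rw [finsum_eq_sum_of_fintype]
  have hsum : ∑ e : OrientedEdge T, edgeCurrent e.u e.v (e.gradR p) (e.gradL p) φ ≤
      ∑ e, E e * c e.u := by
    refine (Finset.sum_le_sum fun e _ => hedge e).trans_eq ?_
    calc _ = (∑ e, E e * c e.u) / 2 + (∑ e, E e * c e.v) / 2 := by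
          rw [Finset.sum_div, Finset.sum_div, ← Finset.sum_add_distrib]
          exact Finset.sum_congr rfl fun e _ => by ring
      _ = _ := by rw [hsymm]; ring
  have hstar := sum_star_le hε.ne' hΦ hT hI E hB
  have hfilter : ∑ e, E e * c e.u = ∑ e : OrientedEdge T with e.u ∈ I, E e := by
    rw [Finset.sum_filter]
    exact Finset.sum_congr rfl fun e _ => by simp [hc]
  rw [hfilter] at hsum
  linarith

theorem D₀_le {ε : ℝ} (hε : 0 < ε) {Φ : Plane ≃ᵃⁱ[ℝ] Plane} (hΦ : IsPositive Φ)
    {T : Complex2} (hT : IsSquareMesh ε Φ T) {I : Finset Plane}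
    (hI : ∀ v, v ∈ I ↔ v ∈ T.vertices ∩ interior T.space) {φ : TwoForm}
    (hφ : IsTestForm (core ε Φ T) φ) (h1 : ∀ z, ‖φ z‖ ≤ 1) (p : Plane → ℝ) {B : ℝ}
    (hB : ∀ (m : ℤ × ℤ) (hm : latVert ε Φ m ∈ interior T.space),
      ∑ k, |areaForm ((hexEdge hε.ne' hΦ hT hm k).gradR p - meanGrad T p (latVert ε Φ m))
        ((hexEdge hε.ne' hΦ hT hm k).gradL p - (hexEdge hε.ne' hΦ hT hm k).gradR p)| ≤ B) :
    D₀ T p φ ≤ I.card * (B / 2) := by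
  classical
  have := hT.finite_orientedEdge
  have := Fintype.ofFinite (OrientedEdge T)
  unfold D₀
  rw [finsum_eq_sum_of_fintype]
  have hzero : ∀ e : OrientedEdge T, e.u ∉ I →
      joinCurrent e.u (meanGrad T p e.u) (e.gradR p) (e.gradL p) φ = 0 := by
    intro e he
    have : e.u ∉ core ε Φ T := fun h => he ((hI _).2
      ⟨mem_vertices_of_mem_face e.left_mem (by simp), hT.core_subset hε h⟩)
    simp [joinCurrent, hφ.eq_zero this]
  have hfilter : ∑ e : OrientedEdge T,
      joinCurrent e.u (meanGrad T p e.u) (e.gradR p) (e.gradL p) φ =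
      ∑ e : OrientedEdge T with e.u ∈ I,
        joinCurrent e.u (meanGrad T p e.u) (e.gradR p) (e.gradL p) φ := by
    rw [Finset.sum_filter]
    refine Finset.sum_congr rfl fun e _ => ?_
    split_ifs with h
    · rfl
    · exact hzero e h
  rw [hfilter]
  refine (Finset.sum_le_sum fun e _ => joinCurrent_le h1 e.u (meanGrad T p e.u) (e.gradR p)
    (e.gradL p)).trans ?_
  refine sum_star_le hε.ne' hΦ hT hI
    (fun e => |areaForm (e.gradR p - meanGrad T p e.u) (e.gradL p - e.gradR p)| / 2) fun m hm => ?_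
  rw [← Finset.sum_div]
  have := hB m hm
  have h2 : ∀ k, (hexEdge hε.ne' hΦ hT hm k).u = latVert ε Φ m := fun _ => rfl
  simp only [h2]
  linarith

/-! ### Gradients on triangles -/

/-- Since the interpolant is prescribed only on the support, its derivative at the centroid is
meaningful only if a whole neighbourhood of the centroid lies in the triangle. -/
theorem centroid_mem_interior_convexHull {T : Complex2} {s : Finset Plane} (hs : s ∈ T.faces)
    (h3 : s.card = 3) : s.centroid ℝ id ∈ interior (convexHull ℝ (s : Set Plane)) := by
  have hind := T.indep hs
  have htop : affineSpan ℝ (Set.range ((↑) : s → Plane)) = ⊤ := by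
    rw [hind.affineSpan_eq_top_iff_card_eq_finrank_add_one, Fintype.card_coe, h3,
      finrank_euclideanSpace_fin]
  have h := AffineBasis.centroid_mem_interior_convexHull
    (⟨((↑) : s → Plane), hind, htop⟩ : AffineBasis s ℝ Plane)
  have hr : Set.range ((↑) : s → Plane) = (s : Set Plane) := Subtype.range_coe
  have hc : Finset.centroid ℝ Finset.univ ((↑) : s → Plane) = s.centroid ℝ id :=
    Finset.centroid_univ ℝ s
  change Finset.centroid ℝ Finset.univ ((↑) : s → Plane) ∈
    interior (convexHull ℝ (Set.range ((↑) : s → Plane))) at h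
  rwa [hr, hc] at h

theorem IsPLInterpolant.inner_triGrad {T : Complex2} {f p : Plane → ℝ}
    (hp : IsPLInterpolant T f p) {s : Finset Plane} (hs : s ∈ T.faces) (h3 : s.card = 3)
    {a b : Plane} (ha : a ∈ s) (hb : b ∈ s) :
    inner ℝ (triGrad p s) (b - a) = f b - f a := by
  obtain ⟨A, hA⟩ := hp.affine s hs
  have hc := centroid_mem_interior_convexHull hs h3
  have heq : p =ᶠ[nhds (s.centroid ℝ id)] A :=
    Filter.eventuallyEq_of_mem (mem_interior_iff_mem_nhds.1 hc) hA
  have hAf : HasFDerivAt A (LinearMap.toContinuousLinearMap A.linear) (s.centroid ℝ id) := by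
    have h := (LinearMap.toContinuousLinearMap A.linear).hasFDerivAt (x := s.centroid ℝ id)
    have h2 := h.add_const (A 0)
    refine h2.congr_of_eventuallyEq (Filter.Eventually.of_forall fun x => ?_)
    have := A.decomp
    exact congrFun this x
  unfold triGrad
  rw [inner_gradient_left, heq.fderiv_eq, hAf.fderiv]
  change A.linear (b - a) = _
  have h := A.linearMap_vsub b a
  rw [vsub_eq_sub] at h
  rw [h, ← hA (subset_convexHull ℝ _ ha), ← hA (subset_convexHull ℝ _ hb),
    hp.vertex a (mem_vertices_of_mem_face hs ha), hp.vertex b (mem_vertices_of_mem_face hs hb)]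
  rfl

/-- A triangle is the closure of its interior, which lies in the interior of the support. The
vertices may lie on the bounding circle, hence the closed ball. -/
theorem face_subset_closedBall {T : Complex2} {x₀ : Plane} {r₀ : ℝ}
    (hint : interior T.space ⊆ Metric.ball x₀ r₀) {s : Finset Plane} (hs : s ∈ T.faces)
    (h3 : s.card = 3) : (s : Set Plane) ⊆ Metric.closedBall x₀ r₀ := by
  have h1 : (s : Set Plane) ⊆ closure (interior (convexHull ℝ (s : Set Plane))) := by
    rw [(convex_convexHull ℝ _).closure_interior_eq_closure_of_nonempty_interior
      ⟨_, centroid_mem_interior_convexHull hs h3⟩]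
    exact (subset_convexHull ℝ _).trans subset_closure
  refine h1.trans (closure_minimal ?_ Metric.isClosed_closedBall)
  exact (interior_mono (T.convexHull_subset_space hs)).trans
    (hint.trans Metric.ball_subset_closedBall)

/-! ### Hessians -/

theorem hessian_apply_eq_sum (f : Plane → ℝ) (x v w : Plane) :
    fderiv ℝ (fun y => fderiv ℝ f y) x v w = ∑ i, ∑ j, hessian f x i j * v i * w j := by
  have hv : ∀ v : Plane, v = v 0 • stdVec 0 + v 1 • stdVec 1 := by
    intro v
    ext i; fin_cases i <;> simp [stdVec]
  conv_lhs => rw [hv v, hv w]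
  simp only [map_add, map_smul, _root_.add_apply, _root_.smul_apply,
    smul_eq_mul, Fin.sum_univ_two, hessian, Matrix.of_apply]
  ring

theorem hsNorm_nonneg (A : Matrix (Fin 2) (Fin 2) ℝ) : 0 ≤ hsNorm A := Real.sqrt_nonneg _

theorem hsNorm_sq (A : Matrix (Fin 2) (Fin 2) ℝ) : hsNorm A ^ 2 = ∑ i, ∑ j, A i j ^ 2 :=
  Real.sq_sqrt (by positivity)

theorem abs_quadratic_le (A : Matrix (Fin 2) (Fin 2) ℝ) (v : Plane) :
    |∑ i, ∑ j, A i j * v i * v j| ≤ hsNorm A * ‖v‖ ^ 2 := by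
  apply abs_le_of_sq_le_sq _ (mul_nonneg (hsNorm_nonneg A) (by positivity))
  rw [mul_pow, hsNorm_sq, EuclideanSpace.norm_sq_eq]
  simp only [Fin.sum_univ_two, Real.norm_eq_abs, sq_abs]
  have := Finset.sum_mul_sq_le_sq_mul_sq Finset.univ (fun q : Fin 2 × Fin 2 => A q.1 q.2)
    (fun q => v q.1 * v q.2)
  simp only [Fintype.sum_prod_type, Fin.sum_univ_two] at this
  nlinarith [this]

theorem hasDerivAt_line {f : Plane → ℝ} {x₀ v : Plane} {r₀ : ℝ}
    (hf : ContDiffOn ℝ 2 f (Metric.ball x₀ r₀)) {t : ℝ} (ht : x₀ + t • v ∈ Metric.ball x₀ r₀) :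
    HasDerivAt (fun s : ℝ => f (x₀ + s • v)) (fderiv ℝ f (x₀ + t • v) v) t ∧
      HasDerivAt (fun s : ℝ => fderiv ℝ f (x₀ + s • v) v)
        (fderiv ℝ (fun y => fderiv ℝ f y) (x₀ + t • v) v v) t := by
  have hline : HasDerivAt (fun s : ℝ => x₀ + s • v) v t := by
    simpa using ((hasDerivAt_id t).smul_const v).const_add x₀
  have hnhds := Metric.isOpen_ball.mem_nhds ht
  have hd : DifferentiableAt ℝ f (x₀ + t • v) :=
    (hf.contDiffAt hnhds).differentiableAt (by norm_num)
  have hd2 : DifferentiableAt ℝ (fun y => fderiv ℝ f y) (x₀ + t • v) :=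
    ((hf.fderiv_of_isOpen Metric.isOpen_ball (m := 1) (by norm_num)).contDiffAt
      hnhds).differentiableAt (by norm_num)
  refine ⟨hd.hasFDerivAt.comp_hasDerivAt t hline, ?_⟩
  have := hd2.hasFDerivAt.comp_hasDerivAt t hline
  exact (this.clm_apply (hasDerivAt_const t v)).congr_deriv (by simp)

/-- Integrate twice along the segment from x₀ the bound ω ‖v‖² for the deviation of the second
derivative from its value at x₀. The point x may lie on the circle, where f need not be
differentiable, so the derivatives are used only for t < 1 and continuity of f supplies t = 1. -/
theorem abs_sub_taylor_le {f : Plane → ℝ} {x₀ x : Plane} {r₀ ω : ℝ} (hr : 0 < r₀)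
    {S : Set Plane} (hf : ContDiffOn ℝ 2 f (Metric.ball x₀ r₀))
    (hfc : ContinuousOn f (Metric.ball x₀ r₀ ∪ S)) (hx : x ∈ Metric.closedBall x₀ r₀)
    (hxS : x ∈ S)
    (hω : ∀ x ∈ Metric.ball x₀ r₀, hsNorm (hessian f x - hessian f x₀) < ω) :
    |f x - f x₀ - fderiv ℝ f x₀ (x - x₀) -
      fderiv ℝ (fun y => fderiv ℝ f y) x₀ (x - x₀) (x - x₀) / 2| ≤ ω * r₀ ^ 2 / 2 := by
  set v := x - x₀ with hv
  have hvr : ‖v‖ ≤ r₀ := by rw [hv, ← dist_eq_norm]; exact hx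
  have hball : ∀ t ∈ Set.Ico (0 : ℝ) 1, x₀ + t • v ∈ Metric.ball x₀ r₀ := by
    intro t ht
    rw [mem_ball_iff_norm, add_sub_cancel_left, norm_smul, Real.norm_of_nonneg ht.1]
    nlinarith [ht.1, ht.2, norm_nonneg v]
  have hω0 : 0 ≤ ω := (hsNorm_nonneg _).trans
    (hω x₀ (Metric.mem_ball_self hr)).le
  set Q := fderiv ℝ (fun y => fderiv ℝ f y) x₀ v v with hQ
  set K := ω * ‖v‖ ^ 2 with hK
  have hbound : ∀ t ∈ Set.Ico (0 : ℝ) 1,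
      |fderiv ℝ (fun y => fderiv ℝ f y) (x₀ + t • v) v v - Q| ≤ K := by
    intro t ht
    have h := abs_quadratic_le (hessian f (x₀ + t • v) - hessian f x₀) v
    rw [hQ, hessian_apply_eq_sum, hessian_apply_eq_sum]
    refine le_trans (le_of_eq ?_) (h.trans (mul_le_mul_of_nonneg_right
      (hω _ (hball t ht)).le (by positivity)))
    congr 1
    simp only [Fin.sum_univ_two, Matrix.sub_apply]
    ring
  have hfirst : ∀ t ∈ Set.Ico (0 : ℝ) 1,
      ‖fderiv ℝ f (x₀ + t • v) v - fderiv ℝ f x₀ v - t * Q‖ ≤ K * t := by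
    intro t ht
    have hin : ∀ s ∈ Set.Icc (0 : ℝ) t, s ∈ Set.Ico (0 : ℝ) 1 := fun s hs =>
      ⟨hs.1, hs.2.trans_lt ht.2⟩
    have hder : ∀ s ∈ Set.Icc (0 : ℝ) t,
        HasDerivAt (fun s : ℝ => fderiv ℝ f (x₀ + s • v) v - fderiv ℝ f x₀ v - s * Q)
          (fderiv ℝ (fun y => fderiv ℝ f y) (x₀ + s • v) v v - Q) s := by
      intro s hs
      have h := (hasDerivAt_line hf (hball s (hin s hs))).2
      exact ((h.sub_const (fderiv ℝ f x₀ v)).sub ((hasDerivAt_id s).mul_const Q)).congr_deriv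
        (by simp)
    refine image_norm_le_of_norm_deriv_right_le_deriv_boundary
      (f' := fun s => fderiv ℝ (fun y => fderiv ℝ f y) (x₀ + s • v) v v - Q)
      (B := fun s => K * s) (B' := fun _ => K)
      (fun s hs => (hder s hs).continuousAt.continuousWithinAt)
      (fun s hs => (hder s (Set.Ico_subset_Icc_self hs)).hasDerivWithinAt) (by simp)
      (fun s => by simpa using (hasDerivAt_id s).const_mul K)
      (fun s hs => hbound s (hin s (Set.Ico_subset_Icc_self hs))) ⟨ht.1, le_rfl⟩
  have hder : ∀ t ∈ Set.Ico (0 : ℝ) 1,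
      HasDerivAt (fun t : ℝ => f (x₀ + t • v) - f x₀ - t * fderiv ℝ f x₀ v - t ^ 2 / 2 * Q)
        (fderiv ℝ f (x₀ + t • v) v - fderiv ℝ f x₀ v - t * Q) t := by
    intro t ht
    have h := (hasDerivAt_line hf (hball t ht)).1
    have h2 : HasDerivAt (fun t : ℝ => t ^ 2 / 2 * Q) (t * Q) t := by
      have := ((hasDerivAt_pow 2 t).div_const 2).mul_const Q
      refine this.congr_deriv ?_
      norm_num
    refine (((h.sub_const (f x₀)).sub
      ((hasDerivAt_id t).mul_const (fderiv ℝ f x₀ v))).sub h2).congr_deriv ?_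
    simp
  have hx1 : x₀ + (1 : ℝ) • v = x := by rw [hv]; simp
  have hcont : ContinuousOn
      (fun t : ℝ => f (x₀ + t • v) - f x₀ - t * fderiv ℝ f x₀ v - t ^ 2 / 2 * Q)
      (Set.Icc 0 1) := by
    have hc : ContinuousOn (fun t : ℝ => f (x₀ + t • v)) (Set.Icc 0 1) := by
      refine hfc.comp (by fun_prop) fun t ht => ?_
      rcases ht.2.lt_or_eq with h | h
      · exact Or.inl (hball t ⟨ht.1, h⟩)
      · right; rw [h, hx1]; exact hxS
    exact ((hc.sub continuousOn_const).sub (by fun_prop)).sub (by fun_prop)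
  have hfin := image_norm_le_of_norm_deriv_right_le_deriv_boundary
    (B := fun t => K * (t ^ 2 / 2)) (B' := fun t => K * t) hcont
    (fun t ht => (hder t ht).hasDerivWithinAt) (by simp)
    (fun t => by
      refine (((hasDerivAt_pow 2 t).div_const 2).const_mul K).congr_deriv ?_
      norm_num) hfirst (Set.right_mem_Icc.2 zero_le_one)
  rw [hx1, Real.norm_eq_abs] at hfin
  have hKr : K ≤ ω * r₀ ^ 2 := by
    rw [hK]; gcongr
  refine le_trans (le_of_eq ?_) (hfin.trans ?_)
  · congr 1; ring
  · linarith

/-- Along the lattice of a mesh whose axes are eigenvectors of the Hessian at `x₀`, the function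
`f` is, up to a small error, the sum of an affine function and a diagonal quadratic form. -/
theorem exists_lattice_expansion {ε : ℝ} (hε : ε ≠ 0) (Φ : Plane ≃ᵃⁱ[ℝ] Plane) {f : Plane → ℝ}
    {x₀ : Plane} {r₀ ω μ ν : ℝ} (hr : 0 < r₀)
    {S : Set Plane} (hf : ContDiffOn ℝ 2 f (Metric.ball x₀ r₀))
    (hfc : ContinuousOn f (Metric.ball x₀ r₀ ∪ S))
    (hω : ∀ x ∈ Metric.ball x₀ r₀, hsNorm (hessian f x - hessian f x₀) < ω)
    (hμ : (hessian f x₀).mulVec (axis Φ 0) = μ • ⇑(axis Φ 0))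
    (hν : (hessian f x₀).mulVec (axis Φ 1) = ν • ⇑(axis Φ 1)) (m : ℤ × ℤ) :
    ∃ A B C : ℝ, ∀ d : ℤ × ℤ, latVert ε Φ (m + d) ∈ Metric.closedBall x₀ r₀ ∩ S →
      |f (latVert ε Φ (m + d)) - (A + B * d.1 + C * d.2 +
        ε ^ 2 / 2 * (μ * d.1 ^ 2 + ν * d.2 ^ 2))| ≤ ω * r₀ ^ 2 / 2 := by
  set D := fderiv ℝ (fun y => fderiv ℝ f y) x₀ with hD
  set L := fderiv ℝ f x₀ with hL
  set w := latVert ε Φ m - x₀ with hw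
  -- Here the second argument is the eigenvector, and in `hD1` likewise with the other axis.
  -- Together they kill both mixed terms without appeal to the symmetry of the Hessian.
  have hD0 : ∀ i, D (axis Φ i) (axis Φ 0) = if i = 0 then μ else 0 := by
    intro i
    have h0 := congrFun hμ 0
    have h1 := congrFun hμ 1
    simp only [Matrix.mulVec, dotProduct, Fin.sum_univ_two, Pi.smul_apply, smul_eq_mul] at h0 h1
    have hij := inner_axis_axis Φ i 0
    rw [hD, hessian_apply_eq_sum]
    simp only [Fin.sum_univ_two]
    calc _ = μ * (axis Φ i 0 * axis Φ 0 0 + axis Φ i 1 * axis Φ 0 1) := by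
          linear_combination axis Φ i 0 * h0 + axis Φ i 1 * h1
      _ = _ := by rw [hij]; simp
  have hD1 : ∀ i, D (axis Φ i) (axis Φ 1) = if i = 1 then ν else 0 := by
    intro i
    have h0 := congrFun hν 0
    have h1 := congrFun hν 1
    simp only [Matrix.mulVec, dotProduct, Fin.sum_univ_two, Pi.smul_apply, smul_eq_mul] at h0 h1
    have hij := inner_axis_axis Φ i 1
    rw [hD, hessian_apply_eq_sum]
    simp only [Fin.sum_univ_two]
    calc _ = ν * (axis Φ i 0 * axis Φ 1 0 + axis Φ i 1 * axis Φ 1 1) := by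
          linear_combination axis Φ i 0 * h0 + axis Φ i 1 * h1
      _ = _ := by rw [hij]; simp
  -- With w the offset of the vertex m from x₀, expanding the Taylor polynomial at w + ε d puts the
  -- cross terms between w and d into the linear coefficients; only the diagonal form in d remains
  -- quadratic.
  refine ⟨f x₀ + L w + D w w / 2,
    ε * (L (axis Φ 0) + (D w (axis Φ 0) + D (axis Φ 0) w) / 2),
    ε * (L (axis Φ 1) + (D w (axis Φ 1) + D (axis Φ 1) w) / 2), fun d hd => ?_⟩
  have hT := abs_sub_taylor_le hr hf hfc hd.1 hd.2 hω
  refine le_trans (le_of_eq ?_) hT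
  have hx : latVert ε Φ (m + d) - x₀ = w + ((ε * d.1) • axis Φ 0 + (ε * d.2) • axis Φ 1) := by
    have : latVert ε Φ (m + d) - latVert ε Φ m =
        (ε * d.1) • axis Φ 0 + (ε * d.2) • axis Φ 1 := by
      have := meshPt_sub_meshPt hε Φ (m + d).1 (m + d).2 m.1 m.2
      simpa [latVert_eq] using this
    rw [← this, hw]
    abel
  rw [hx, ← hD, ← hL]
  congr 1
  simp only [map_add, map_smul, _root_.add_apply, _root_.smul_apply,
    smul_eq_mul, hD0, hD1]
  simp
  ring

/-! ### The polygon of gradients at an interior vertex -/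

/-- The signs of the first coordinates of the gradients of a diagonal quadratic form on the
triangles at a vertex. -/
def signX : Fin 6 → ℝ := ![1, -1, -1, -1, 1, 1]

/-- The signs of the second coordinates of the gradients of a diagonal quadratic form on the
triangles at a vertex. -/
def signY : Fin 6 → ℝ := ![1, 1, 1, -1, -1, -1]

theorem fin_six_sub_one :
    (0 : Fin 6) - 1 = 5 ∧ (1 : Fin 6) - 1 = 0 ∧ (2 : Fin 6) - 1 = 1 ∧ (3 : Fin 6) - 1 = 2 ∧
      (4 : Fin 6) - 1 = 3 ∧ (5 : Fin 6) - 1 = 4 := by decide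

/-- The rescaled gradients `(X k, Y k)` on the six triangles at a vertex of the mesh, when the
function is, up to an error `M`, the sum of an affine function and a diagonal quadratic form. -/
structure NearRectangle (a b B C M : ℝ) (X Y : Fin 6 → ℝ) : Prop where
  nearX : ∀ k, |X k - (B + signX k * (a / 2))| ≤ 2 * M
  nearY : ∀ k, |Y k - (C + signY k * (b / 2))| ≤ 2 * M
  jump₀ : X 0 = X 5
  jump₁ : Y 1 = Y 0
  jump₂ : X 2 - X 1 = Y 2 - Y 1
  jump₃ : X 3 = X 2
  jump₄ : Y 4 = Y 3
  jump₅ : X 5 - X 4 = Y 5 - Y 4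

namespace NearRectangle

variable {a b B C M : ℝ} {X Y : Fin 6 → ℝ}

theorem abs_mul_le_mul {u v α β : ℝ} (hu : |u| ≤ α) (hv : |v| ≤ β) : |u * v| ≤ α * β := by
  rw [abs_mul]
  exact mul_le_mul hu hv (abs_nonneg _) ((abs_nonneg _).trans hu)

theorem abs_sub_le_of_near {s : Fin 6 → ℝ} (h : ∀ k, |X k - (B + s k * (a / 2))| ≤ 2 * M)
    (k j : Fin 6) : |X k - X j| ≤ |s k - s j| / 2 * |a| + 4 * M := by
  have e : X k - X j = (X k - (B + s k * (a / 2))) - (X j - (B + s j * (a / 2))) +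
      (s k - s j) / 2 * a := by ring
  have h1 := abs_add_le ((X k - (B + s k * (a / 2))) - (X j - (B + s j * (a / 2))))
    ((s k - s j) / 2 * a)
  have h2 := abs_sub (X k - (B + s k * (a / 2))) (X j - (B + s j * (a / 2)))
  rw [← e, abs_mul, abs_div, abs_two] at h1
  linarith [h k, h j]

/-- The signs cancel in the mean, which is therefore within 2M of the centre B of the rectangle; the
other 2M is the error of the gradient itself. -/
theorem abs_sub_mean_le_of_near {s : Fin 6 → ℝ} (hs : ∑ j, s j = 0) (hs1 : ∀ k, |s k| = 1)
    (h : ∀ k, |X k - (B + s k * (a / 2))| ≤ 2 * M) (k : Fin 6) :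
    |X k - (∑ j, X j) / 6| ≤ |a| / 2 + 4 * M := by
  have hm : |∑ j, (X j - (B + s j * (a / 2)))| ≤ 6 * (2 * M) := by
    refine (Finset.abs_sum_le_sum_abs _ _).trans ((Finset.sum_le_sum fun j _ => h j).trans_eq ?_)
    simp
  have e1 : ∑ j, (X j - (B + s j * (a / 2))) = ∑ j, X j - 6 * B := by
    rw [Finset.sum_sub_distrib, Finset.sum_add_distrib, ← Finset.sum_mul, hs]
    simp
  have e2 : |s k * (a / 2)| = |a| / 2 := by rw [abs_mul, hs1, abs_div, abs_two, one_mul]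
  rw [e1] at hm
  have hk := h k
  have hk' := e2.le
  rw [abs_le] at hm hk hk' ⊢
  constructor <;> linarith [hm.1, hm.2, hk.1, hk.2, hk'.1, hk'.2]

theorem signX_spec : ∑ j, signX j = 0 ∧ ∀ k, |signX k| = 1 := by
  refine ⟨by simp [Fin.sum_univ_six, signX], fun k => ?_⟩
  fin_cases k <;> simp [signX]

theorem signY_spec : ∑ j, signY j = 0 ∧ ∀ k, |signY k| = 1 := by
  refine ⟨by simp [Fin.sum_univ_six, signY], fun k => ?_⟩
  fin_cases k <;> simp [signY]

theorem jump_bounds (h : NearRectangle a b B C M X Y) :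
    |Y 0 - Y 5| ≤ |b| + 4 * M ∧ |X 1 - X 0| ≤ |a| + 4 * M ∧ |X 2 - X 1| ≤ 4 * M ∧
      |Y 3 - Y 2| ≤ |b| + 4 * M ∧ |X 4 - X 3| ≤ |a| + 4 * M ∧ |X 5 - X 4| ≤ 4 * M := by
  have x := abs_sub_le_of_near h.nearX
  have y := abs_sub_le_of_near h.nearY
  have h2 : |(-1 : ℝ) - 1| / 2 = 1 ∧ |(1 : ℝ) - -1| / 2 = 1 := by norm_num
  refine ⟨(y 0 5).trans_eq ?_, (x 1 0).trans_eq ?_, (x 2 1).trans_eq ?_, (y 3 2).trans_eq ?_,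
    (x 4 3).trans_eq ?_, (x 5 4).trans_eq ?_⟩
  · change |(1 : ℝ) - -1| / 2 * _ + _ = _
    rw [h2.2, one_mul]
  · change |(-1 : ℝ) - 1| / 2 * _ + _ = _
    rw [h2.1, one_mul]
  · change |(-1 : ℝ) - -1| / 2 * _ + _ = _
    simp
  · change |(-1 : ℝ) - 1| / 2 * _ + _ = _
    rw [h2.1, one_mul]
  · change |(1 : ℝ) - -1| / 2 * _ + _ = _
    rw [h2.2, one_mul]
  · change |(1 : ℝ) - 1| / 2 * _ + _ = _
    simp

/-- An edge along an axis has ℓ¹ length 1 and a jump in only one coordinate, at most |a| + 4M or |b|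
+ 4M. A diagonal edge has ℓ¹ length 2 and equal jumps of at most 4M in both coordinates,
contributing 16M. The errors add up to 4 · 4M + 2 · 16M = 48M. -/
theorem sum_jump_le (h : NearRectangle a b B C M X Y) :
    ∑ k, (|((hexDir k).1 : ℝ)| + |((hexDir k).2 : ℝ)|) *
      (|X k - X (k - 1)| + |Y k - Y (k - 1)|) ≤ 2 * (|a| + |b| + 24 * M) := by
  obtain ⟨i0, i1, i2, i3, i4, i5⟩ := fin_six_sub_one
  obtain ⟨y0, x1, x2, y3, x4, x5⟩ := h.jump_bounds
  have z0 : X 0 - X 5 = 0 := sub_eq_zero.2 h.jump₀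
  have z1 : Y 1 - Y 0 = 0 := sub_eq_zero.2 h.jump₁
  have z3 : X 3 - X 2 = 0 := sub_eq_zero.2 h.jump₃
  have z4 : Y 4 - Y 3 = 0 := sub_eq_zero.2 h.jump₄
  simp only [Fin.sum_univ_six, i0, i1, i2, i3, i4, i5, ← h.jump₂, ← h.jump₅, z0, z1, z3, z4,
    abs_zero]
  simp [hexDir]
  linarith

/-- On the four axis edges one of the two products vanishes, and the other is a half side times a
side of the rectangle, up to errors. On the two diagonal edges the jump is (s, s) with |s| ≤ 4M, so
those terms contain no |ab|. -/
theorem sum_area_le (h : NearRectangle a b B C M X Y) :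
    ∑ k, |(X (k - 1) - (∑ j, X j) / 6) * (Y k - Y (k - 1)) -
      (Y (k - 1) - (∑ j, Y j) / 6) * (X k - X (k - 1))| ≤
      2 * (|a * b| + 8 * (|a| + |b|) * M + 64 * M ^ 2) := by
  obtain ⟨i0, i1, i2, i3, i4, i5⟩ := fin_six_sub_one
  have mx := abs_sub_mean_le_of_near signX_spec.1 signX_spec.2 h.nearX
  have my := abs_sub_mean_le_of_near signY_spec.1 signY_spec.2 h.nearY
  set cx := (∑ j, X j) / 6
  set cy := (∑ j, Y j) / 6
  obtain ⟨y0, x1, x2, y3, x4, x5⟩ := h.jump_bounds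
  have hdiag : ∀ {u v s : ℝ}, |u| ≤ |a| / 2 + 4 * M → |v| ≤ |b| / 2 + 4 * M → |s| ≤ 4 * M →
      |u * s - v * s| ≤ (|a| / 2 + 4 * M + (|b| / 2 + 4 * M)) * (4 * M) := by
    intro u v s hu hv hs
    rw [← sub_mul]
    exact abs_mul_le_mul ((abs_sub u v).trans (add_le_add hu hv)) hs
  have t0 := abs_mul_le_mul (mx 5) y0
  have t1 := abs_mul_le_mul (my 0) x1
  have t2 := hdiag (mx 1) (my 1) x2
  have t3 := abs_mul_le_mul (mx 2) y3
  have t4 := abs_mul_le_mul (my 3) x4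
  have t5 := hdiag (mx 4) (my 4) x5
  have z0 : X 0 - X 5 = 0 := sub_eq_zero.2 h.jump₀
  have z1 : Y 1 - Y 0 = 0 := sub_eq_zero.2 h.jump₁
  have z3 : X 3 - X 2 = 0 := sub_eq_zero.2 h.jump₃
  have z4 : Y 4 - Y 3 = 0 := sub_eq_zero.2 h.jump₄
  simp only [Fin.sum_univ_six, i0, i1, i2, i3, i4, i5, ← h.jump₂, ← h.jump₅, z0, z1, z3, z4,
    mul_zero, sub_zero, zero_sub, abs_neg, abs_mul a b]
  nlinarith [t0, t1, t2, t3, t4, t5]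

/-- The rescaled gradients are close to the vertices of a rectangle if the values at the vertices
of the hexagon are close to those of an affine function plus a diagonal quadratic form. -/
theorem of_values {A : ℝ} {F₀ : ℝ} {F : Fin 6 → ℝ} (h₀ : |F₀ - A| ≤ M)
    (hF : ∀ k, |F k - (A + B * (hexDir k).1 + C * (hexDir k).2 +
      (a * (hexDir k).1 ^ 2 + b * (hexDir k).2 ^ 2) / 2)| ≤ M)
    (hl : ∀ k, X k * (hexDir k).1 + Y k * (hexDir k).2 = F k - F₀)
    (hr : ∀ k, X k * (hexDir (k + 1)).1 + Y k * (hexDir (k + 1)).2 = F (k + 1) - F₀) :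
    NearRectangle a b B C M X Y := by
  have k01 : (0 : Fin 6) + 1 = 1 := rfl
  have k12 : (1 : Fin 6) + 1 = 2 := rfl
  have k23 : (2 : Fin 6) + 1 = 3 := rfl
  have k34 : (3 : Fin 6) + 1 = 4 := rfl
  have k45 : (4 : Fin 6) + 1 = 5 := rfl
  have k50 : (5 : Fin 6) + 1 = 0 := rfl
  have f0 := hF 0
  have f1 := hF 1
  have f2 := hF 2
  have f3 := hF 3
  have f4 := hF 4
  have f5 := hF 5
  have l0 := hl 0
  have l1 := hl 1
  have l2 := hl 2
  have l3 := hl 3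
  have l4 := hl 4
  have l5 := hl 5
  have r0 := hr 0
  have r1 := hr 1
  have r2 := hr 2
  have r3 := hr 3
  have r4 := hr 4
  have r5 := hr 5
  simp only [k01, k12, k23, k34, k45, k50] at r0 r1 r2 r3 r4 r5
  simp [hexDir] at l0 l1 l2 l3 l4 l5 r0 r1 r2 r3 r4 r5
  simp [hexDir, abs_le] at f0 f1 f2 f3 f4 f5
  rw [abs_le] at h₀
  constructor
  -- Every triangle has a leg along each axis, so each coordinate of its gradient is, up to sign,
  -- the difference of the values at the ends of a leg: two errors M each.
  · intro k
    rw [abs_le]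
    fin_cases k <;> simp [signX] <;> constructor <;> linarith
  · intro k
    rw [abs_le]
    fin_cases k <;> simp [signY] <;> constructor <;> linarith
  -- Adjacent gradients agree along their common edge, so the jump is orthogonal to that edge.
  all_goals linarith

end NearRectangle

section Vertex

variable {ε : ℝ} (hε : 0 < ε) {Φ : Plane ≃ᵃⁱ[ℝ] Plane} (hΦ : IsPositive Φ) {T : Complex2}
  (hT : IsSquareMesh ε Φ T) {m : ℤ × ℤ} (hm : latVert ε Φ m ∈ interior T.space)

theorem card_hex_triangle {ε : ℝ} (hε : ε ≠ 0) (Φ : Plane ≃ᵃⁱ[ℝ] Plane) (m : ℤ × ℤ) (k : Fin 6)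
    [DecidableEq Plane] :
    ({latVert ε Φ m, latVert ε Φ (m + hexDir k), latVert ε Φ (m + hexDir (k + 1))} :
      Finset Plane).card = 3 := by
  have hd : ∀ k, hexDir k ≠ 0 ∧ hexDir k ≠ hexDir (k + 1) := by decide
  refine Finset.card_eq_three.2 ⟨_, _, _, fun h => ?_, fun h => ?_, fun h => ?_, rfl⟩
  · exact (hd k).1 (left_eq_add.1 (latVert_injective hε Φ h))
  · exact (hd (k + 1)).1 (left_eq_add.1 (latVert_injective hε Φ h))
  · exact (hd k).2 (add_left_cancel (latVert_injective hε Φ h))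

theorem inner_gradL_hexEdge {f p : Plane → ℝ} (hp : IsPLInterpolant T f p) (k : Fin 6)
    {d : ℤ × ℤ} (hd : d = hexDir k ∨ d = hexDir (k + 1)) :
    ε * axisCoord Φ 0 ((hexEdge hε.ne' hΦ hT hm k).gradL p) * d.1 +
      ε * axisCoord Φ 1 ((hexEdge hε.ne' hΦ hT hm k).gradL p) * d.2 =
      f (latVert ε Φ (m + d)) - f (latVert ε Φ m) := by
  classical
  have h := hp.inner_triGrad (hexEdge hε.ne' hΦ hT hm k).left_mem
    (card_hex_triangle hε.ne' Φ m k) (a := latVert ε Φ m) (b := latVert ε Φ (m + d))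
    (by simp [hexEdge]) (by rcases hd with rfl | rfl <;> simp [hexEdge])
  rw [inner_eq_axisCoord Φ, (axisCoord_latVert_sub hε.ne' Φ _ _).1,
    (axisCoord_latVert_sub hε.ne' Φ _ _).2] at h
  rw [← h, OrientedEdge.gradL]
  simp
  ring

theorem latVert_mem_closedBall {ε : ℝ} (hε : 0 < ε) {Φ : Plane ≃ᵃⁱ[ℝ] Plane} {T : Complex2}
    (hT : IsSquareMesh ε Φ T) {m : ℤ × ℤ} (hm : latVert ε Φ m ∈ interior T.space)
    {x₀ : Plane} {r₀ : ℝ} (hint : interior T.space ⊆ Metric.ball x₀ r₀) (k : Fin 6) :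
    latVert ε Φ (m + hexDir k) ∈ Metric.closedBall x₀ r₀ ∩ T.space := by
  classical
  have hface := hT.hex_mem_faces hε.ne' hm k
  have h3 := card_hex_triangle hε.ne' Φ m k
  exact ⟨face_subset_closedBall hint hface (by convert h3) (by simp),
    T.subset_space hface (by simp)⟩

/-- The bounds for the edge part and the vertex part of the gradient cycle at one vertex. -/
theorem vertex_bounds {f p : Plane → ℝ} (hp : IsPLInterpolant T f p) {x₀ : Plane}
    {r₀ ω μ ν : ℝ} (hr : 0 < r₀) (hint : interior T.space ⊆ Metric.ball x₀ r₀)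
    (hf : ContDiffOn ℝ 2 f (Metric.ball x₀ r₀))
    (hfc : ContinuousOn f (Metric.ball x₀ r₀ ∪ T.space))
    (hω : ∀ x ∈ Metric.ball x₀ r₀, hsNorm (hessian f x - hessian f x₀) < ω)
    (hμ : (hessian f x₀).mulVec (axis Φ 0) = μ • ⇑(axis Φ 0))
    (hν : (hessian f x₀).mulVec (axis Φ 1) = ν • ⇑(axis Φ 1)) :
    ∑ k, ‖(hexEdge hε.ne' hΦ hT hm k).v - (hexEdge hε.ne' hΦ hT hm k).u‖ *
        ‖(hexEdge hε.ne' hΦ hT hm k).gradL p - (hexEdge hε.ne' hΦ hT hm k).gradR p‖ ≤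
        2 * ((|μ| + |ν|) * ε ^ 2 + 12 * ω * r₀ ^ 2) ∧
    ∑ k, |areaForm ((hexEdge hε.ne' hΦ hT hm k).gradR p - meanGrad T p (latVert ε Φ m))
        ((hexEdge hε.ne' hΦ hT hm k).gradL p - (hexEdge hε.ne' hΦ hT hm k).gradR p)| ≤
        2 * (|μ * ν| * ε ^ 2 + 4 * (|μ| + |ν|) * (ω * r₀ ^ 2) + 16 * (ω * r₀ ^ 2) ^ 2 / ε ^ 2) := by
  obtain ⟨A, B, C, hexp⟩ := exists_lattice_expansion hε.ne' Φ hr hf hfc hω hμ hν m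
  set G : Fin 6 → Plane := fun k => (hexEdge hε.ne' hΦ hT hm k).gradL p with hG
  have hGR : ∀ k, (hexEdge hε.ne' hΦ hT hm k).gradR p = G (k - 1) :=
    hexEdge_gradR hε.ne' hΦ hT hm p
  have hnear : NearRectangle (μ * ε ^ 2) (ν * ε ^ 2) B C (ω * r₀ ^ 2 / 2)
      (fun k => ε * axisCoord Φ 0 (G k)) (fun k => ε * axisCoord Φ 1 (G k)) := by
    refine NearRectangle.of_values (A := A) (F₀ := f (latVert ε Φ m))
      (F := fun k => f (latVert ε Φ (m + hexDir k))) ?_ (fun k => ?_) (fun k => ?_) fun k => ?_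
    · have := hexp 0 (by
        rw [add_zero]
        exact ⟨Metric.ball_subset_closedBall (hint hm), interior_subset hm⟩)
      simpa using this
    · refine le_trans (le_of_eq ?_) (hexp _ (latVert_mem_closedBall hε hT hm hint k))
      congr 2
      ring
    · exact inner_gradL_hexEdge hε hΦ hT hm hp k (Or.inl rfl)
    · exact inner_gradL_hexEdge hε hΦ hT hm hp k (Or.inr rfl)
  have hε2 : 0 < ε ^ 2 := by positivity
  constructor
  · refine le_trans (Finset.sum_le_sum fun k _ => ?_) (hnear.sum_jump_le.trans_eq ?_)
    · rw [hGR]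
      change ‖latVert ε Φ (m + hexDir k) - latVert ε Φ m‖ * ‖G k - G (k - 1)‖ ≤ _
      refine (mul_le_mul (norm_le_axisCoord Φ _) (norm_le_axisCoord Φ _) (norm_nonneg _)
        (by positivity)).trans_eq ?_
      rw [(axisCoord_latVert_sub hε.ne' Φ _ _).1, (axisCoord_latVert_sub hε.ne' Φ _ _).2,
        axisCoord_sub, axisCoord_sub, ← mul_sub, ← mul_sub]
      simp only [abs_mul, abs_of_pos hε, Prod.fst_add, Prod.snd_add, Int.cast_add,
        add_sub_cancel_left]
      ring
    · rw [abs_mul, abs_mul, abs_of_pos hε2]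
      ring
  · have hterm : ∀ k, |areaForm ((hexEdge hε.ne' hΦ hT hm k).gradR p -
        meanGrad T p (latVert ε Φ m)) ((hexEdge hε.ne' hΦ hT hm k).gradL p -
        (hexEdge hε.ne' hΦ hT hm k).gradR p)| = (ε ^ 2)⁻¹ *
        |(ε * axisCoord Φ 0 (G (k - 1)) - (∑ j, ε * axisCoord Φ 0 (G j)) / 6) *
          (ε * axisCoord Φ 1 (G k) - ε * axisCoord Φ 1 (G (k - 1))) -
        (ε * axisCoord Φ 1 (G (k - 1)) - (∑ j, ε * axisCoord Φ 1 (G j)) / 6) *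
          (ε * axisCoord Φ 0 (G k) - ε * axisCoord Φ 0 (G (k - 1)))| := by
      intro k
      have hsum : ∀ i, axisCoord Φ i (∑ j, G j) = ∑ j, axisCoord Φ i (G j) := fun i =>
        inner_sum _ _ _
      rw [hGR, meanGrad_eq hε.ne' hΦ hT hm, areaForm_eq_axisCoord hΦ]
      simp only [axisCoord_sub, axisCoord_smul]
      change |(_ - 6⁻¹ * axisCoord Φ 0 (∑ j, G j)) * _ -
        (_ - 6⁻¹ * axisCoord Φ 1 (∑ j, G j)) * _| = _
      rw [hsum, hsum, ← Finset.mul_sum, ← Finset.mul_sum]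
      have habs : ∀ z : ℝ, (ε ^ 2)⁻¹ * |z| = |(ε ^ 2)⁻¹ * z| := fun z => by
        rw [abs_mul, abs_of_pos (inv_pos.2 hε2)]
      rw [habs]
      congr 1
      change (_ - _) * (axisCoord Φ 1 (G k) - _) - (_ - _) * (axisCoord Φ 0 (G k) - _) = _
      field_simp
    rw [Finset.sum_congr rfl fun k _ => hterm k, ← Finset.mul_sum, inv_mul_le_iff₀ hε2]
    refine hnear.sum_area_le.trans_eq ?_
    simp only [abs_mul, abs_of_pos hε2]
    field_simp
    ring

end Vertex

/-! ### Norms and determinants of Hessians -/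

theorem hsNorm_eq_norm (A : Matrix (Fin 2) (Fin 2) ℝ) :
    hsNorm A = ‖(WithLp.toLp 2 fun q : Fin 2 × Fin 2 => A q.1 q.2 :
      EuclideanSpace ℝ (Fin 2 × Fin 2))‖ := by
  rw [EuclideanSpace.norm_eq, hsNorm]
  simp [Fintype.sum_prod_type]

theorem hsNorm_le_add (A B : Matrix (Fin 2) (Fin 2) ℝ) :
    hsNorm A ≤ hsNorm B + hsNorm (A - B) := by
  rw [hsNorm_eq_norm, hsNorm_eq_norm, hsNorm_eq_norm]
  refine le_trans (le_of_eq ?_) (norm_add_le _ _)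
  congr 1
  ext q
  simp

theorem abs_apply_le_hsNorm (A : Matrix (Fin 2) (Fin 2) ℝ) (i j : Fin 2) :
    |A i j| ≤ hsNorm A := by
  rw [hsNorm_eq_norm]
  exact PiLp.norm_apply_le (WithLp.toLp 2 fun q : Fin 2 × Fin 2 => A q.1 q.2 :
      EuclideanSpace ℝ (Fin 2 × Fin 2)) (i, j)

theorem hsNorm_sub_comm (A B : Matrix (Fin 2) (Fin 2) ℝ) : hsNorm (A - B) = hsNorm (B - A) := by
  simp only [hsNorm, Matrix.sub_apply, sub_sq_comm]

/-- Expand det(B + E) with E = A - B: four products of an entry of B with one of E, and two products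
of entries of E. -/
theorem abs_det_sub_le (A B : Matrix (Fin 2) (Fin 2) ℝ) :
    |A.det - B.det| ≤ 4 * hsNorm B * hsNorm (A - B) + 2 * hsNorm (A - B) ^ 2 := by
  have hB := abs_apply_le_hsNorm B
  have hE := abs_apply_le_hsNorm (A - B)
  have e : A.det - B.det = B 0 0 * (A - B) 1 1 + B 1 1 * (A - B) 0 0 - B 0 1 * (A - B) 1 0 -
      B 1 0 * (A - B) 0 1 + (A - B) 0 0 * (A - B) 1 1 - (A - B) 0 1 * (A - B) 1 0 := by
    simp only [Matrix.det_fin_two, Matrix.sub_apply]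
    ring
  have t1 := abs_le.1 (NearRectangle.abs_mul_le_mul (hB 0 0) (hE 1 1))
  have t2 := abs_le.1 (NearRectangle.abs_mul_le_mul (hB 1 1) (hE 0 0))
  have t3 := abs_le.1 (NearRectangle.abs_mul_le_mul (hB 0 1) (hE 1 0))
  have t4 := abs_le.1 (NearRectangle.abs_mul_le_mul (hB 1 0) (hE 0 1))
  have t5 := abs_le.1 (NearRectangle.abs_mul_le_mul (hE 0 0) (hE 1 1))
  have t6 := abs_le.1 (NearRectangle.abs_mul_le_mul (hE 0 1) (hE 1 0))
  rw [e, abs_le]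
  constructor <;> linarith

theorem sq_det_axis (Φ : Plane ≃ᵃⁱ[ℝ] Plane) :
    (axis Φ 0 0 * axis Φ 1 1 - axis Φ 0 1 * axis Φ 1 0) ^ 2 = 1 := by
  have o00 := inner_axis_axis Φ 0 0
  have o11 := inner_axis_axis Φ 1 1
  have o01 := inner_axis_axis Φ 0 1
  simp at o00 o11 o01
  linear_combination o00 * (axis Φ 1 0 ^ 2 + axis Φ 1 1 ^ 2) + o11 -
    o01 * (axis Φ 0 0 * axis Φ 1 0 + axis Φ 0 1 * axis Φ 1 1)

/-- The Hilbert-Schmidt norm can be computed in the orthonormal frame of the axes, where its square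
is μ² + ν²; then (|μ| + |ν|)² ≤ 2(μ² + ν²). For the determinant, multiply by that of the frame,
which is ±1. -/
theorem eigenvalue_bounds (Φ : Plane ≃ᵃⁱ[ℝ] Plane) {H : Matrix (Fin 2) (Fin 2) ℝ} {μ ν : ℝ}
    (hμ : H.mulVec (axis Φ 0) = μ • ⇑(axis Φ 0)) (hν : H.mulVec (axis Φ 1) = ν • ⇑(axis Φ 1)) :
    |μ| + |ν| ≤ √2 * hsNorm H ∧ μ * ν = H.det := by
  have m0 := congrFun hμ 0
  have m1 := congrFun hμ 1
  have n0 := congrFun hν 0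
  have n1 := congrFun hν 1
  simp only [Matrix.mulVec, dotProduct, Fin.sum_univ_two, Pi.smul_apply, smul_eq_mul]
    at m0 m1 n0 n1
  have o00 := inner_axis_axis Φ 0 0
  have o11 := inner_axis_axis Φ 1 1
  have o01 := inner_axis_axis Φ 0 1
  simp at o00 o11 o01
  constructor
  · have hrow : ∀ i, H i 0 ^ 2 + H i 1 ^ 2 = (H i 0 * axis Φ 0 0 + H i 1 * axis Φ 0 1) ^ 2 +
        (H i 0 * axis Φ 1 0 + H i 1 * axis Φ 1 1) ^ 2 := by
      intro i
      have h := inner_eq_axisCoord Φ !₂[H i 0, H i 1] !₂[H i 0, H i 1]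
      simp only [axisCoord, PiLp.inner_apply, Fin.sum_univ_two] at h
      simp at h
      linarith
    have hsq : hsNorm H ^ 2 = μ ^ 2 + ν ^ 2 := by
      rw [hsNorm_sq]
      simp only [Fin.sum_univ_two]
      rw [hrow 0, hrow 1, m0, m1, n0, n1]
      linear_combination μ ^ 2 * o00 + ν ^ 2 * o11
    apply abs_le_of_sq_le_sq' _ (mul_nonneg (Real.sqrt_nonneg _) (hsNorm_nonneg _)) |>.2
    rw [mul_pow, hsq, Real.sq_sqrt (by norm_num)]
    nlinarith [sq_nonneg (|μ| - |ν|), sq_abs μ, sq_abs ν]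
  · have hdet := sq_det_axis Φ
    have hne : axis Φ 0 0 * axis Φ 1 1 - axis Φ 0 1 * axis Φ 1 0 ≠ 0 := by
      intro h; rw [h] at hdet; norm_num at hdet
    apply mul_right_cancel₀ hne
    rw [Matrix.det_fin_two]
    linear_combination -(H 1 0 * axis Φ 1 0 + H 1 1 * axis Φ 1 1) * m0 +
      (H 0 0 * axis Φ 1 0 + H 0 1 * axis Φ 1 1) * m1 - μ * axis Φ 0 0 * n1 + μ * axis Φ 0 1 * n0

/-! ### Integrability -/

theorem continuousOn_hessian {f : Plane → ℝ} {U : Set Plane} (hU : IsOpen U)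
    (hf : ContDiffOn ℝ 2 f U) (i j : Fin 2) : ContinuousOn (fun x => hessian f x i j) U := by
  have h1 := hf.fderiv_of_isOpen hU (m := 1) (by norm_num)
  have h2 := h1.continuousOn_fderiv_of_isOpen hU le_rfl
  exact (h2.clm_apply continuousOn_const).clm_apply continuousOn_const

theorem integrableOn_hessian {f : Plane → ℝ} {x₀ : Plane} {r₀ ω : ℝ}
    (hf : ContDiffOn ℝ 2 f (Metric.ball x₀ r₀))
    (hω : ∀ x ∈ Metric.ball x₀ r₀, hsNorm (hessian f x - hessian f x₀) < ω)
    {W : Set Plane} (hW : MeasurableSet W) (hWb : W ⊆ Metric.ball x₀ r₀) :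
    IntegrableOn (fun x => 1 + 2 * √2 * hsNorm (hessian f x) + |(hessian f x).det|) W := by
  have hc := continuousOn_hessian Metric.isOpen_ball hf
  have hcont : ContinuousOn
      (fun x => 1 + 2 * √2 * hsNorm (hessian f x) + |(hessian f x).det|) W := by
    refine ContinuousOn.mono ?_ hWb
    simp only [hsNorm, Matrix.det_fin_two, Fin.sum_univ_two]
    have h00 := hc 0 0
    have h01 := hc 0 1
    have h10 := hc 1 0
    have h11 := hc 1 1
    fun_prop
  have hvol : volume W ≠ ⊤ :=
    ((measure_mono hWb).trans_lt measure_ball_lt_top).ne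
  refine IntegrableOn.of_bound (C := 1 + 2 * √2 * (hsNorm (hessian f x₀) + ω) +
    (|(hessian f x₀).det| + (4 * hsNorm (hessian f x₀) * ω + 2 * ω ^ 2))) hvol.lt_top
    (hcont.aestronglyMeasurable hW) ?_
  filter_upwards [ae_restrict_mem hW] with x hx
  have hx' := hω x (hWb hx)
  have h1 := hsNorm_le_add (hessian f x) (hessian f x₀)
  have h2 := abs_det_sub_le (hessian f x) (hessian f x₀)
  have h0 := hsNorm_nonneg (hessian f x - hessian f x₀)
  have h3 := abs_sub_abs_le_abs_sub (hessian f x).det (hessian f x₀).det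
  have h4 : 4 * hsNorm (hessian f x₀) * hsNorm (hessian f x - hessian f x₀) +
      2 * hsNorm (hessian f x - hessian f x₀) ^ 2 ≤
      4 * hsNorm (hessian f x₀) * ω + 2 * ω ^ 2 := by
    have := hsNorm_nonneg (hessian f x₀)
    gcongr
  have h5 : hsNorm (hessian f x) ≤ hsNorm (hessian f x₀) + ω := by linarith
  rw [Real.norm_of_nonneg (by have := hsNorm_nonneg (hessian f x); positivity)]
  have h6 := mul_le_mul_of_nonneg_left h5 (show 0 ≤ 2 * √2 by positivity)
  linarith

/-- The integrand is bounded below by its value at x₀ minus 2√2 ω + 4‖H‖ω + 2ω², exactly the part of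
the error bracket that is free of ε. -/
theorem const_le_setIntegral_hessian {f : Plane → ℝ} {x₀ : Plane} {r₀ ω : ℝ}
    (hf : ContDiffOn ℝ 2 f (Metric.ball x₀ r₀))
    (hω : ∀ x ∈ Metric.ball x₀ r₀, hsNorm (hessian f x - hessian f x₀) < ω)
    {W : Set Plane} (hW : MeasurableSet W) (hWb : W ⊆ Metric.ball x₀ r₀) :
    volume.real W * (1 + 2 * √2 * (hsNorm (hessian f x₀) - ω) +
      (|(hessian f x₀).det| - (4 * hsNorm (hessian f x₀) * ω + 2 * ω ^ 2))) ≤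
    ∫ x in W, (1 + 2 * √2 * hsNorm (hessian f x) + |(hessian f x).det|) := by
  have hvol : volume W ≠ ⊤ :=
    ((measure_mono hWb).trans_lt measure_ball_lt_top).ne
  rw [← smul_eq_mul, ← setIntegral_const]
  refine setIntegral_mono_on (integrableOn_const hvol) (integrableOn_hessian hf hω hW hWb) hW
    fun x hx => ?_
  have hx' := hω x (hWb hx)
  have h1 := hsNorm_le_add (hessian f x₀) (hessian f x)
  rw [hsNorm_sub_comm] at h1
  have h2 := abs_det_sub_le (hessian f x) (hessian f x₀)
  have h0 := hsNorm_nonneg (hessian f x - hessian f x₀)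
  have h3 := abs_sub_abs_le_abs_sub (hessian f x₀).det (hessian f x).det
  rw [abs_sub_comm] at h3
  have h4 : 4 * hsNorm (hessian f x₀) * hsNorm (hessian f x - hessian f x₀) +
      2 * hsNorm (hessian f x - hessian f x₀) ^ 2 ≤
      4 * hsNorm (hessian f x₀) * ω + 2 * ω ^ 2 := by
    have := hsNorm_nonneg (hessian f x₀)
    gcongr
  have h5 : hsNorm (hessian f x₀) - ω ≤ hsNorm (hessian f x) := by linarith
  have h6 := mul_le_mul_of_nonneg_left h5 (show 0 ≤ 2 * √2 by positivity)
  linarith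

/-! ### Exchanging the axes -/

/-- The reflection that exchanges the coordinates of the plane. -/
def coordSwap : Plane ≃ₗᵢ[ℝ] Plane :=
  LinearIsometryEquiv.piLpCongrLeft 2 ℝ ℝ (Equiv.swap (0 : Fin 2) 1)

theorem coordSwap_apply (v : Plane) : coordSwap v = !₂[v 1, v 0] := by
  ext i
  fin_cases i <;> simp [coordSwap, LinearIsometryEquiv.piLpCongrLeft_apply,
    Equiv.piCongrLeft'_apply]

/-- The congruence of a mesh with exchanged axes. -/
def swapAxes (Φ : Plane ≃ᵃⁱ[ℝ] Plane) : Plane ≃ᵃⁱ[ℝ] Plane :=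
  coordSwap.toAffineIsometryEquiv.trans Φ

theorem axis_swapAxes (Φ : Plane ≃ᵃⁱ[ℝ] Plane) :
    axis (swapAxes Φ) 0 = axis Φ 1 ∧ axis (swapAxes Φ) 1 = axis Φ 0 := by
  have h : ∀ v, (swapAxes Φ).linearIsometryEquiv v = Φ.linearIsometryEquiv (coordSwap v) :=
    fun _ => rfl
  constructor
  · rw [axis, axis, h, coordSwap_apply]
    congr 1
    ext i; fin_cases i <;> simp [stdVec]
  · rw [axis, axis, h, coordSwap_apply]
    congr 1
    ext i; fin_cases i <;> simp [stdVec]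

theorem latVert_swapAxes (ε : ℝ) (Φ : Plane ≃ᵃⁱ[ℝ] Plane) (m : ℤ × ℤ) :
    latVert ε (swapAxes Φ) m = latVert ε Φ m.swap := by
  change Φ (coordSwap _) = Φ _
  rw [coordSwap_apply]
  rfl

theorem core_swapAxes (ε : ℝ) (Φ : Plane ≃ᵃⁱ[ℝ] Plane) (T : Complex2) :
    core ε (swapAxes Φ) T = core ε Φ T := by
  have h : closedSquare ε (swapAxes Φ) = closedSquare ε Φ := by
    funext v
    ext x
    simp only [closedSquare, Set.mem_ofPred_eq, Fin.forall_fin_two, (axis_swapAxes Φ).1,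
      (axis_swapAxes Φ).2]
    exact and_comm
  rw [core, core, h]

/-- Transposing the coordinates preserves the lattice and its diagonals of slope -1, and maps lower
triangles to lower and upper to upper. -/
theorem IsSquareMesh.swapAxes {ε : ℝ} {Φ : Plane ≃ᵃⁱ[ℝ] Plane} {T : Complex2}
    (hT : IsSquareMesh ε Φ T) : IsSquareMesh ε (swapAxes Φ) T := by
  refine ⟨hT.finite, fun s hs => ?_⟩
  obtain ⟨t, ⟨hne, m, n, hmn⟩, hst⟩ := hT.faces s hs
  refine ⟨t.image Prod.swap, ⟨hne.image _, n, m, ?_⟩, ?_⟩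
  · refine hmn.imp (fun h => (Finset.image_subset_image h).trans ?_)
      fun h => (Finset.image_subset_image h).trans ?_
    · intro q
      simp only [Finset.image_insert, Finset.image_singleton, Prod.swap_prod_mk,
        Finset.mem_insert, Finset.mem_singleton]
      tauto
    · intro q
      simp only [Finset.image_insert, Finset.image_singleton, Prod.swap_prod_mk,
        Finset.mem_insert, Finset.mem_singleton]
      tauto
  · rw [hst, Finset.coe_image, Set.image_image]
    refine Set.image_congr fun q _ => ?_
    exact ((latVert_swapAxes ε Φ q.swap).trans (by rw [Prod.swap_swap]; rfl)).symm

theorem isPositive_or_swapAxes (Φ : Plane ≃ᵃⁱ[ℝ] Plane) :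
    IsPositive Φ ∨ IsPositive (swapAxes Φ) := by
  have hdet := sq_det_axis Φ
  unfold IsPositive areaForm
  rw [(axis_swapAxes Φ).1, (axis_swapAxes Φ).2]
  rcases sq_eq_sq_iff_eq_or_eq_neg.1 (hdet.trans (one_pow 2).symm) with h | h
  · exact Or.inl h
  · right; linarith

/-! ### The estimate of the mass -/

theorem massOver_gradientCycle_le {ε : ℝ} (hε : 0 < ε) {Φ : Plane ≃ᵃⁱ[ℝ] Plane}
    (hΦ : IsPositive Φ) {T : Complex2} (hT : IsSquareMesh ε Φ T) {f p : Plane → ℝ}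
    (hp : IsPLInterpolant T f p) {x₀ : Plane}
    {r₀ ω μ ν : ℝ} (hr : 0 < r₀) (hint : interior T.space ⊆ Metric.ball x₀ r₀)
    (hf : ContDiffOn ℝ 2 f (Metric.ball x₀ r₀))
    (hfc : ContinuousOn f (Metric.ball x₀ r₀ ∪ T.space))
    (hω : ∀ x ∈ Metric.ball x₀ r₀, hsNorm (hessian f x - hessian f x₀) < ω)
    (hμ : (hessian f x₀).mulVec (axis Φ 0) = μ • ⇑(axis Φ 0))
    (hν : (hessian f x₀).mulVec (axis Φ 1) = ν • ⇑(axis Φ 1)) :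
    massOver (core ε Φ T) (gradientCycle T p) ≤
      ENNReal.ofReal (volume.real (core ε Φ T) *
        (1 + (|μ| + |ν|) + |μ * ν| + ε⁻¹ ^ 2 * (12 * ω * r₀ ^ 2 +
          4 * (|μ| + |ν|) * (ω * r₀ ^ 2)) + 16 * ε⁻¹ ^ 4 * (ω * r₀ ^ 2) ^ 2)) := by
  have hI := (hT.finite_vertices.inter_of_left (interior T.space))
  have hω0 : 0 ≤ ω := (hsNorm_nonneg _).trans (hω x₀ (Metric.mem_ball_self hr)).le
  refine iSup_le fun φ => ENNReal.ofReal_le_ofReal ?_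
  obtain ⟨φ, hφ, h1⟩ := φ
  have hD2 : _ ≤ volume.real (core ε Φ T) :=
    D₂_le hT.finite isOpen_interior (volume_core_lt_top hε hT).ne hφ h1 p
  have hD1 := D₁_le hε hΦ hT (I := hI.toFinset) (fun v => hI.mem_toFinset) hφ h1 p
    fun m hm => (vertex_bounds hε hΦ hT hm hp hr hint hf hfc hω hμ hν).1
  have hD0 := D₀_le hε hΦ hT (I := hI.toFinset) (fun v => hI.mem_toFinset) hφ h1 p
    fun m hm => (vertex_bounds hε hΦ hT hm hp hr hint hf hfc hω hμ hν).2
  have hN := card_mul_le_volume_core hε hT hI.toFinset (fun v => hI.mem_toFinset.1)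
  set N : ℝ := (hI.toFinset.card : ℝ)
  set V := volume.real (core ε Φ T)
  set K := (|μ| + |ν|) + |μ * ν| + ε⁻¹ ^ 2 * (12 * ω * r₀ ^ 2 +
          4 * (|μ| + |ν|) * (ω * r₀ ^ 2)) + 16 * ε⁻¹ ^ 4 * (ω * r₀ ^ 2) ^ 2 with hK
  have hK0 : 0 ≤ K := by positivity
  have hNK := mul_le_mul_of_nonneg_right hN hK0
  -- K is chosen so that ε² K is the sum of the edge and vertex charges of one interior vertex.
  have e : N * ε ^ 2 * K = N * (((|μ| + |ν|) * ε ^ 2 + 12 * ω * r₀ ^ 2) +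
      (|μ * ν| * ε ^ 2 + 4 * (|μ| + |ν|) * (ω * r₀ ^ 2) + 16 * (ω * r₀ ^ 2) ^ 2 / ε ^ 2)) := by
    rw [hK]
    field_simp
    ring
  change gradientCycle T p φ ≤ _
  unfold gradientCycle
  have e2 : V * (1 + (|μ| + |ν|) + |μ * ν| + ε⁻¹ ^ 2 * (12 * ω * r₀ ^ 2 +
          4 * (|μ| + |ν|) * (ω * r₀ ^ 2)) + 16 * ε⁻¹ ^ 4 * (ω * r₀ ^ 2) ^ 2) = V + V * K := by
    rw [hK]; ring
  rw [e2]
  linarith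

theorem massOver_lt_of_isPositive {ε r₀ ω : ℝ} (hε : 0 < ε) {x₀ : Plane}
    {Φ : Plane ≃ᵃⁱ[ℝ] Plane} (hΦ : IsPositive Φ) {T : Complex2} (hT : IsSquareMesh ε Φ T)
    (hint : interior T.space ⊆ Metric.ball x₀ r₀) (hcore : (core ε Φ T).Nonempty)
    {f : Plane → ℝ} (hf : ContDiffOn ℝ 2 f (Metric.ball x₀ r₀))
    (hfc : ContinuousOn f (Metric.ball x₀ r₀ ∪ T.space))
    (haxes : ∀ i : Fin 2, ∃ μ : ℝ, (hessian f x₀).mulVec (axis Φ i) = μ • ⇑(axis Φ i))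
    (hω : ∀ x ∈ Metric.ball x₀ r₀, hsNorm (hessian f x - hessian f x₀) < ω) :
    massOver (core ε Φ T) (gradientCycle T (plInterp T f)) <
      ENNReal.ofReal
        ((∫ x in core ε Φ T, (1 + 2 * √2 * hsNorm (hessian f x) + |(hessian f x).det|))
          + volume.real (core ε Φ T) *
            (12 * √2 * ε⁻¹ ^ 2 * ω * r₀ ^ 2
              + 24 * hsNorm (hessian f x₀) * ε⁻¹ ^ 2 * ω * r₀ ^ 2
              + 24 * ε⁻¹ ^ 4 * ω ^ 2 * r₀ ^ 4
              + 2 * ω * √2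
              + 4 * hsNorm (hessian f x₀) * ω
              + 2 * ω ^ 2)) := by
  have hcb : core ε Φ T ⊆ Metric.ball x₀ r₀ := (hT.core_subset hε).trans hint
  have hr : 0 < r₀ := Metric.nonempty_ball.1 (hcore.mono hcb)
  have hω0 : 0 < ω := (hsNorm_nonneg _).trans_lt (hω x₀ (Metric.mem_ball_self hr))
  obtain ⟨μ, hμ⟩ := haxes 0
  obtain ⟨ν, hν⟩ := haxes 1
  obtain ⟨hsum, hdet⟩ := eigenvalue_bounds Φ hμ hν
  have hmass := massOver_gradientCycle_le hε hΦ hT (plInterp_spec T f) hr hint hf hfc hω hμ hν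
  have hI := const_le_setIntegral_hessian hf hω isOpen_interior.measurableSet hcb
  have hV : 0 < volume.real (core ε Φ T) :=
    ENNReal.toReal_pos (isOpen_interior.measure_pos volume hcore).ne'
      (volume_core_lt_top hε hT).ne
  change volume.real (core ε Φ T) * _ ≤ ∫ x in core ε Φ T, _ at hI
  refine hmass.trans_lt ((ENNReal.ofReal_lt_ofReal_iff_of_nonneg (by positivity)).2 ?_)
  rw [hdet]
  set V := volume.real (core ε Φ T)
  set h := hsNorm (hessian f x₀)
  have hh : 0 ≤ h := hsNorm_nonneg _
  have h2 : 1 < √2 := by rw [Real.lt_sqrt] <;> norm_num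
  have h2' : √2 < 2 := by rw [Real.sqrt_lt'] <;> norm_num
  set P := ε⁻¹ ^ 2 * (ω * r₀ ^ 2) with hP
  have hP0 : 0 < P := by positivity
  have key : 1 + (|μ| + |ν|) + |(hessian f x₀).det| + ε⁻¹ ^ 2 * (12 * ω * r₀ ^ 2 +
      4 * (|μ| + |ν|) * (ω * r₀ ^ 2)) + 16 * ε⁻¹ ^ 4 * (ω * r₀ ^ 2) ^ 2 <
      (1 + 2 * √2 * (h - ω) + (|(hessian f x₀).det| - (4 * h * ω + 2 * ω ^ 2))) +
      (12 * √2 * ε⁻¹ ^ 2 * ω * r₀ ^ 2 + 24 * h * ε⁻¹ ^ 2 * ω * r₀ ^ 2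
        + 24 * ε⁻¹ ^ 4 * ω ^ 2 * r₀ ^ 4 + 2 * ω * √2 + 4 * h * ω + 2 * ω ^ 2) := by
    have e1 : ε⁻¹ ^ 2 * (12 * ω * r₀ ^ 2 + 4 * (|μ| + |ν|) * (ω * r₀ ^ 2)) +
        16 * ε⁻¹ ^ 4 * (ω * r₀ ^ 2) ^ 2 = 12 * P + 4 * ((|μ| + |ν|) * P) + 16 * P ^ 2 := by
      rw [hP]; ring
    have e2 : 12 * √2 * ε⁻¹ ^ 2 * ω * r₀ ^ 2 + 24 * h * ε⁻¹ ^ 2 * ω * r₀ ^ 2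
        + 24 * ε⁻¹ ^ 4 * ω ^ 2 * r₀ ^ 4 = 12 * (√2 * P) + 24 * (h * P) + 24 * P ^ 2 := by
      rw [hP]; ring
    -- The crude form with 2 in place of √2 is enough for the product with P: it gives 8hP against
    -- the available 24hP. The sharper `hsum` is used for the main term.
    have s1 : |μ| + |ν| ≤ 2 * h := hsum.trans (mul_le_mul_of_nonneg_right h2'.le hh)
    have s2 := mul_le_mul_of_nonneg_right s1 hP0.le
    have s3 := mul_lt_mul_of_pos_right h2 hP0
    have s4 : 0 ≤ h * P := by positivity
    have s5 : 0 ≤ P ^ 2 := by positivity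
    have s6 : 0 ≤ √2 * h := by positivity
    linarith
  have := mul_lt_mul_of_pos_left key hV
  rw [mul_add] at this
  linarith

end PLApprox

end

theorem lemma2p6 (ε r₀ ω : ℝ) (hε : 0 < ε) (x₀ : PLApprox.Plane)
    (Φ : PLApprox.Plane ≃ᵃⁱ[ℝ] PLApprox.Plane) (T : PLApprox.Complex2)
    (hT : PLApprox.IsSquareMesh ε Φ T)
    (hint : interior T.space ⊆ Metric.ball x₀ r₀)
    (hcore : (PLApprox.core ε Φ T).Nonempty)
    (f : PLApprox.Plane → ℝ)
    (hf : ContDiffOn ℝ 2 f (Metric.ball x₀ r₀))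
    (hfc : ContinuousOn f (Metric.ball x₀ r₀ ∪ T.space))
    (haxes : ∀ i : Fin 2, ∃ μ : ℝ,
      (PLApprox.hessian f x₀).mulVec (PLApprox.axis Φ i) = μ • ⇑(PLApprox.axis Φ i))
    (hω : ∀ x ∈ Metric.ball x₀ r₀,
      PLApprox.hsNorm (PLApprox.hessian f x - PLApprox.hessian f x₀) < ω) :
    MeasureTheory.IntegrableOn (fun x => 1 + 2 * √2 * PLApprox.hsNorm (PLApprox.hessian f x)
        + |(PLApprox.hessian f x).det|) (PLApprox.core ε Φ T) ∧
    PLApprox.massOver (PLApprox.core ε Φ T)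
        (PLApprox.gradientCycle T (PLApprox.plInterp T f)) <
      ENNReal.ofReal
        ((∫ x in PLApprox.core ε Φ T, (1 + 2 * √2 * PLApprox.hsNorm (PLApprox.hessian f x)
            + |(PLApprox.hessian f x).det|))
          + MeasureTheory.volume.real (PLApprox.core ε Φ T) *
            (12 * √2 * ε⁻¹ ^ 2 * ω * r₀ ^ 2
              + 24 * PLApprox.hsNorm (PLApprox.hessian f x₀) * ε⁻¹ ^ 2 * ω * r₀ ^ 2
              + 24 * ε⁻¹ ^ 4 * ω ^ 2 * r₀ ^ 4
              + 2 * ω * √2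
              + 4 * PLApprox.hsNorm (PLApprox.hessian f x₀) * ω
              + 2 * ω ^ 2)) := by
  refine ⟨PLApprox.integrableOn_hessian hf hω isOpen_interior.measurableSet
    ((hT.core_subset hε).trans hint), ?_⟩
  -- A congruence may reverse orientation. Exchanging the axes then makes the frame positive and
  -- changes neither the core nor the eigenvector condition.
  rcases PLApprox.isPositive_or_swapAxes Φ with hΦ | hΦ
  · exact PLApprox.massOver_lt_of_isPositive hε hΦ hT hint hcore hf hfc haxes hω
  · have haxes' : ∀ i : Fin 2, ∃ μ : ℝ, (PLApprox.hessian f x₀).mulVec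
        (PLApprox.axis (PLApprox.swapAxes Φ) i) =
        μ • ⇑(PLApprox.axis (PLApprox.swapAxes Φ) i) := by
      rw [Fin.forall_fin_two, (PLApprox.axis_swapAxes Φ).1, (PLApprox.axis_swapAxes Φ).2]
      exact ⟨haxes 1, haxes 0⟩
    have h := PLApprox.massOver_lt_of_isPositive hε hΦ hT.swapAxes hint
      (by rwa [PLApprox.core_swapAxes]) hf hfc haxes' hω
    rwa [PLApprox.core_swapAxes] at h
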